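/- Let $k$ be an algebraically closed field of characteristic $0$. For a finite group $\Gamma$, let $D(\Gamma)$ be its Drinfeld double: the Hopf algebra over $k$ with basis $(e_gh)_{g,h\in\Gamma}$, product $(e_gh)(e_{g'}h')=\delta_{g,hg'h^{-1}}\,e_g(hh')$, unit $\sum_g e_g$ (where $e_g=e_g1$), coproduct $\Delta(e_gh)=\sum_{g_1g_2=g}e_{g_2}h\otimes e_{g_1}h$, counit $\varepsilon(e_gh)=\delta_{g,1}$, antipode $S(e_gh)=e_{h^{-1}g^{-1}h}h^{-1}$ and universal $R$-matrix $R=\sum_{g}g\otimes e_g$, where $g$ stands for $\sum_x e_xg$. Let $D(\Gamma)\text{-}\mathrm{mod}$ be the monoidal category of its finite-dimensional modules, with the braiding $c_{M,N}$ given by the action of $R$ followed by the flip, and with the twist $\theta$ given by the action of $\sum_g e_gg$ (the twist corresponding to the usual identification of a vector space with its bidual as pivotal structure). For a central element $z$ of $\Gamma$, let $V_{z,1}$ be the one-dimensional module on which $e_gh$ acts by $\delta_{g,z}$. For a $D(\Gamma)$-module $X$ and $g\in\Gamma$, the centralizer $Z_\Gamma(g)$ acts on $e_gX$. Let $1\to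 A\to\tilde G\to G\to 1$ be a central extension of a finite group $G$ by a finite cyclic group $A$, and let $\hat A$ be the group of homomorphisms $A\to k^\times$. For $\alpha\in\hat A$, let $(D(\tilde G)\text{-}\mathrm{mod})_\alpha$ be the full subcategory of the objects $X$ such that $c_{X,V_{a,1}}\circ c_{V_{a,1},X}=\alpha(a)\,\mathrm{id}_{V_{a,1}\otimes X}$ for all $a\in A$. Recall that a premodular category over $k$ is a braided fusion category with a twist (a natural automorphism $\theta$ of the identity functor with $\theta_{X\otimes Y}=(\theta_X\otimes\theta_Y)c_{Y,X}c_{X,Y}$) whose associated pivotal structure is spherical; it is modular if its $S$-matrix $S_{X,Y}=\mathrm{tr}(c_{Y,X}c_{X,Y})$, indexed by the isomorphism classes of simple objects, is invertible. A modularization of a premodular category $\mathcal C$ is a modular category $\mathcal D$ with a $k$-linear braided monoidal functor $F\colon\mathcal C\to\mathcal D$ that preserves the twist and is dominant: every object of $\mathcal D$ is a direct summand of $F(X)$ for some object $X$ of $\mathcal C$. Then: 1. The subcategories $(D(\tilde G)\text{-}\mathrm{mod})_\alpha$ define a grading by $\hat A$: every simple object belongs to exactly one of them, and the tensor product of an object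 of degree $\alpha$ and an object of degree $\beta$ has degree $\alpha\beta$. If $X$ is a simple $D(\tilde G)$-module and $g\in\tilde G$ is such that $e_gX\neq0$, then $X$ has degree $\alpha$ if and only if $A\subset Z_{\tilde G}(g)$ acts on the representation $e_gX$ of $Z_{\tilde G}(g)$ by the character $\alpha$. 2. The component $(D(\tilde G)\text{-}\mathrm{mod})_1$ of trivial degree is premodular, $D(G)\text{-}\mathrm{mod}$ is modular, and there is a functor $F\colon(D(\tilde G)\text{-}\mathrm{mod})_1\to D(G)\text{-}\mathrm{mod}$ that is a modularization of $(D(\tilde G)\text{-}\mathrm{mod})_1$. -/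

import Mathlib

open CategoryTheory MonoidalCategory
open scoped TensorProduct

universe u v w

/-- A finite-dimensional left module over a `k`-algebra `H`: a finite-dimensional `k`-vector space
with an algebra homomorphism from `H` to its endomorphism algebra. -/
structure FDMod (k : Type u) [Field k] (H : Type v) [Ring H] [Algebra k H] where
  V : Type u
  [addCommGroup : AddCommGroup V]
  [module : Module k V]
  [finite : Module.Finite k V]
  act : H →ₐ[k] Module.End k V

namespace FDMod

attribute [instance] FDMod.addCommGroup FDMod.module FDMod.finite

section Linear

variable {k : Type u} [Field k] {H : Type v} [Ring H] [Algebra k H]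

/-- `H`-linear maps. -/
@[ext]
structure Hom (M N : FDMod k H) where
  lin : M.V →ₗ[k] N.V
  comm : ∀ (x : H) (m : M.V), lin (M.act x m) = N.act x (lin m)

instance : Category (FDMod k H) where
  Hom M N := Hom M N
  id M := ⟨LinearMap.id, fun _ _ => rfl⟩
  comp f g := ⟨g.lin ∘ₗ f.lin, fun x m => by simp [f.comm, g.comm]⟩

@[simp] theorem id_lin (M : FDMod k H) : Hom.lin (𝟙 M) = LinearMap.id := rfl

@[simp] theorem comp_lin {M N P : FDMod k H} (f : M ⟶ N) (g : N ⟶ P) :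
    Hom.lin (f ≫ g) = Hom.lin g ∘ₗ Hom.lin f := rfl

@[ext] theorem hom_ext {M N : FDMod k H} {f g : M ⟶ N} (h : Hom.lin f = Hom.lin g) : f = g :=
  Hom.ext h

/-- The `k`-subspace of `H`-linear maps. -/
def homSubmodule (M N : FDMod k H) : Submodule k (M.V →ₗ[k] N.V) where
  carrier := {f | ∀ (x : H) (m : M.V), f (M.act x m) = N.act x (f m)}
  add_mem' hf hg x m := by simp [hf x m, hg x m]
  zero_mem' x m := by simp
  smul_mem' c f hf x m := by simp [hf x m]

/-- A morphism is the same as an element of the space of `H`-linear maps. -/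
def homEquiv (M N : FDMod k H) : (M ⟶ N) ≃ homSubmodule M N where
  toFun f := ⟨Hom.lin f, Hom.comm f⟩
  invFun f := ⟨f.1, f.2⟩
  left_inv _ := rfl
  right_inv _ := rfl

instance (M N : FDMod k H) : AddCommGroup (M ⟶ N) := (homEquiv M N).addCommGroup

instance (M N : FDMod k H) : Module k (M ⟶ N) := (homEquiv M N).module k

@[simp] theorem add_lin {M N : FDMod k H} (f g : M ⟶ N) :
    Hom.lin (f + g) = Hom.lin f + Hom.lin g := rfl

@[simp] theorem smul_lin {M N : FDMod k H} (c : k) (f : M ⟶ N) :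
    Hom.lin (c • f) = c • Hom.lin f := rfl

@[simp] theorem zero_lin {M N : FDMod k H} : Hom.lin (0 : M ⟶ N) = 0 := rfl

instance : Preadditive (FDMod k H) where
  add_comp _ _ _ f f' g := by ext; simp
  comp_add _ _ _ f g g' := by ext; simp

instance : Linear k (FDMod k H) where
  smul_comp _ _ _ r f g := by ext; simp
  comp_smul _ _ _ f r g := by ext; simp

/-- An isomorphism from an equivariant linear equivalence. -/
def isoMk {M N : FDMod k H} (e : M.V ≃ₗ[k] N.V)
    (he : ∀ (x : H) (m : M.V), e (M.act x m) = N.act x (e m)) : M ≅ N where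
  hom := ⟨e.toLinearMap, he⟩
  inv := ⟨e.symm.toLinearMap, fun x n => e.injective (by simp [he])⟩
  hom_inv_id := by ext; simp
  inv_hom_id := by ext; simp

@[simp] theorem isoMk_hom_lin {M N : FDMod k H} (e : M.V ≃ₗ[k] N.V)
    (he : ∀ (x : H) (m : M.V), e (M.act x m) = N.act x (e m)) :
    Hom.lin (isoMk e he).hom = e.toLinearMap := rfl

@[simp] theorem isoMk_inv_lin {M N : FDMod k H} (e : M.V ≃ₗ[k] N.V)
    (he : ∀ (x : H) (m : M.V), e (M.act x m) = N.act x (e m)) :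
    Hom.lin (isoMk e he).inv = e.symm.toLinearMap := rfl

end Linear

section Monoidal

variable {k : Type u} [Field k] {H : Type v} [Ring H] [Bialgebra k H]

/-- The action of `H ⊗ H` on the tensor product of two `H`-modules. -/
noncomputable def act₂ (M N : FDMod k H) : H ⊗[k] H →ₐ[k] Module.End k (M.V ⊗[k] N.V) :=
  (Module.endTensorEndAlgHom (R := k) (S := k) (A := k)).comp
    (Algebra.TensorProduct.map M.act N.act)

@[simp] theorem act₂_tmul (M N : FDMod k H) (x y : H) (m : M.V) (n : N.V) :
    act₂ M N (x ⊗ₜ y) (m ⊗ₜ n) = M.act x m ⊗ₜ N.act y n := rfl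

/-- The tensor product of two modules over a bialgebra: `H` acts through its comultiplication. -/
noncomputable abbrev tensor (M N : FDMod k H) : FDMod k H where
  V := M.V ⊗[k] N.V
  act := (act₂ M N).comp (Bialgebra.comulAlgHom k H)

theorem tensor_act (M N : FDMod k H) (x : H) :
    (tensor M N).act x = act₂ M N (Coalgebra.comul (R := k) x) := rfl

/-- The unit object: `H` acts on `k` through its counit. -/
noncomputable abbrev unit : FDMod k H where
  V := k
  act := (Algebra.lmul k k).comp (Bialgebra.counitAlgHom k H)

theorem unit_act (x : H) (c : k) :
    (unit (k := k) (H := H)).act x c = Coalgebra.counit (R := k) x * c := rfl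

theorem map_act₂ {M M' N N' : FDMod k H} (f : M ⟶ M') (g : N ⟶ N') (t : H ⊗[k] H)
    (z : M.V ⊗[k] N.V) :
    TensorProduct.map (Hom.lin f) (Hom.lin g) (act₂ M N t z) =
      act₂ M' N' t (TensorProduct.map (Hom.lin f) (Hom.lin g) z) := by
  induction t with
  | zero => simp
  | add s t hs ht => simp [hs, ht]
  | tmul x y =>
    induction z with
    | zero => simp
    | add z z' hz hz' => simp only [map_add, hz, hz']
    | tmul m n => simp [Hom.comm f, Hom.comm g]

/-- The tensor product of two morphisms. -/
noncomputable def tensorMap {M M' N N' : FDMod k H} (f : M ⟶ M') (g : N ⟶ N') :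
    tensor M N ⟶ tensor M' N' :=
  ⟨TensorProduct.map (Hom.lin f) (Hom.lin g), fun _ z => map_act₂ f g _ z⟩

/-- The action of `H ⊗ (H ⊗ H)` on a triple tensor product. -/
noncomputable def act₃ (M N P : FDMod k H) :
    H ⊗[k] (H ⊗[k] H) →ₗ[k] Module.End k (M.V ⊗[k] (N.V ⊗[k] P.V)) :=
  TensorProduct.lift (((TensorProduct.mapBilinear (RingHom.id k) M.V (N.V ⊗[k] P.V) M.V
    (N.V ⊗[k] P.V)).compl₂ (act₂ N P).toLinearMap) ∘ₗ M.act.toLinearMap)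

@[simp] theorem act₃_tmul (M N P : FDMod k H) (x : H) (t : H ⊗[k] H) (m : M.V)
    (z : N.V ⊗[k] P.V) :
    act₃ M N P (x ⊗ₜ t) (m ⊗ₜ z) = M.act x m ⊗ₜ act₂ N P t z := rfl

theorem assoc_act (M N P : FDMod k H) (x : H) (z : (M.V ⊗[k] N.V) ⊗[k] P.V) :
    TensorProduct.assoc k M.V N.V P.V ((tensor (tensor M N) P).act x z) =
      (tensor M (tensor N P)).act x (TensorProduct.assoc k M.V N.V P.V z) := by
  have h1 : ∀ (t : H ⊗[k] H) (z : M.V ⊗[k] (N.V ⊗[k] P.V)),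
      act₂ M (tensor N P) t z =
        act₃ M N P (LinearMap.lTensor H (Coalgebra.comul (R := k)) t) z := by
    intro t z
    induction t with
    | zero => simp
    | add s t hs ht => simp only [map_add, LinearMap.add_apply, hs, ht]
    | tmul a b =>
      induction z with
      | zero => simp
      | add z z' hz hz' => simp only [map_add, hz, hz']
      | tmul m n => rfl
  have h2 : ∀ (s : H ⊗[k] H) (b : H) (m : M.V) (n : N.V) (p : P.V),
      TensorProduct.assoc k M.V N.V P.V (act₂ M N s (m ⊗ₜ n) ⊗ₜ P.act b p) =
        act₃ M N P (TensorProduct.assoc k H H H (s ⊗ₜ b)) (m ⊗ₜ (n ⊗ₜ p)) := by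
    intro s b m n p
    induction s with
    | zero => simp
    | add s t hs ht => simp only [map_add, LinearMap.add_apply, TensorProduct.add_tmul, hs, ht]
    | tmul a c => simp
  have h3 : ∀ (t : H ⊗[k] H) (m : M.V) (n : N.V) (p : P.V),
      TensorProduct.assoc k M.V N.V P.V (act₂ (tensor M N) P t ((m ⊗ₜ n) ⊗ₜ p)) =
        act₃ M N P (TensorProduct.assoc k H H H
          (LinearMap.rTensor H (Coalgebra.comul (R := k)) t)) (m ⊗ₜ (n ⊗ₜ p)) := by
    intro t m n p
    induction t with
    | zero => simp
    | add s t hs ht => simp only [map_add, LinearMap.add_apply, hs, ht]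
    | tmul a b =>
      rw [LinearMap.rTensor_tmul, ← h2]; rfl
  rw [tensor_act, tensor_act]
  induction z with
  | zero => simp
  | add z z' hz hz' => simp only [map_add, hz, hz']
  | tmul z p =>
    induction z with
    | zero => simp
    | add z z' hz hz' => simp only [map_add, TensorProduct.add_tmul, hz, hz']
    | tmul m n => rw [h3, Coalgebra.coassoc_apply, h1, TensorProduct.assoc_tmul]

theorem lid_act (M : FDMod k H) (x : H) (z : k ⊗[k] M.V) :
    TensorProduct.lid k M.V ((tensor unit M).act x z) = M.act x (TensorProduct.lid k M.V z) := by
  have h : ∀ (t : H ⊗[k] H) (c : k) (m : M.V),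
      TensorProduct.lid k M.V (act₂ unit M t (c ⊗ₜ m)) =
        c • M.act (TensorProduct.lid k H
          (LinearMap.rTensor H (Coalgebra.counit (R := k)) t)) m := by
    intro t c m
    induction t with
    | zero => simp
    | add s t hs ht => simp only [map_add, LinearMap.add_apply, smul_add, hs, ht]
    | tmul a b =>
      change TensorProduct.lid k M.V ((Coalgebra.counit (R := k) a * c) ⊗ₜ M.act b m) = _
      simp [mul_smul, smul_comm c]
  rw [tensor_act]
  induction z with
  | zero => simp
  | add z z' hz hz' => simp only [map_add, hz, hz']
  | tmul c m => rw [h, Coalgebra.rTensor_counit_comul]; simp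

theorem rid_act (M : FDMod k H) (x : H) (z : M.V ⊗[k] k) :
    TensorProduct.rid k M.V ((tensor M unit).act x z) = M.act x (TensorProduct.rid k M.V z) := by
  have h : ∀ (t : H ⊗[k] H) (c : k) (m : M.V),
      TensorProduct.rid k M.V (act₂ M unit t (m ⊗ₜ c)) =
        c • M.act (TensorProduct.rid k H
          (LinearMap.lTensor H (Coalgebra.counit (R := k)) t)) m := by
    intro t c m
    induction t with
    | zero => simp
    | add s t hs ht => simp only [map_add, LinearMap.add_apply, smul_add, hs, ht]
    | tmul a b =>
      change TensorProduct.rid k M.V (M.act a m ⊗ₜ (Coalgebra.counit (R := k) b * c)) = _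
      simp [mul_smul, smul_comm c]
  rw [tensor_act]
  induction z with
  | zero => simp
  | add z z' hz hz' => simp only [map_add, hz, hz']
  | tmul c m => rw [h, Coalgebra.lTensor_counit_comul]; simp

noncomputable instance : MonoidalCategoryStruct (FDMod k H) where
  tensorObj := tensor
  tensorUnit := unit
  tensorHom f g := tensorMap f g
  whiskerLeft M _ _ f := tensorMap (𝟙 M) f
  whiskerRight f N := tensorMap f (𝟙 N)
  associator M N P := isoMk (TensorProduct.assoc k M.V N.V P.V) (assoc_act M N P)
  leftUnitor M := isoMk (TensorProduct.lid k M.V) (lid_act M)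
  rightUnitor M := isoMk (TensorProduct.rid k M.V) (rid_act M)

theorem tensorObj_V (M N : FDMod k H) : (M ⊗ N).V = (M.V ⊗[k] N.V) := rfl

@[simp] theorem tensorHom_lin {M M' N N' : FDMod k H} (f : M ⟶ M') (g : N ⟶ N') :
    Hom.lin (f ⊗ₘ g) = TensorProduct.map (Hom.lin f) (Hom.lin g) := rfl

@[simp] theorem whiskerLeft_lin (M : FDMod k H) {N N' : FDMod k H} (g : N ⟶ N') :
    Hom.lin (M ◁ g) = TensorProduct.map LinearMap.id (Hom.lin g) := rfl

@[simp] theorem whiskerRight_lin {M M' : FDMod k H} (f : M ⟶ M') (N : FDMod k H) :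
    Hom.lin (f ▷ N) = TensorProduct.map (Hom.lin f) LinearMap.id := rfl

@[simp] theorem associator_hom_lin (M N P : FDMod k H) :
    Hom.lin (α_ M N P).hom = (TensorProduct.assoc k M.V N.V P.V).toLinearMap := rfl

@[simp] theorem associator_inv_lin (M N P : FDMod k H) :
    Hom.lin (α_ M N P).inv = (TensorProduct.assoc k M.V N.V P.V).symm.toLinearMap := rfl

@[simp] theorem leftUnitor_hom_lin (M : FDMod k H) :
    Hom.lin (λ_ M).hom = (TensorProduct.lid k M.V).toLinearMap := rfl

@[simp] theorem rightUnitor_hom_lin (M : FDMod k H) :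
    Hom.lin (ρ_ M).hom = (TensorProduct.rid k M.V).toLinearMap := rfl

noncomputable instance : MonoidalCategory (FDMod k H) :=
  MonoidalCategory.ofTensorHom
    (id_tensorHom_id := fun _ _ => hom_ext TensorProduct.map_id)
    (id_tensorHom := fun _ _ _ _ => rfl)
    (tensorHom_id := fun _ _ => rfl)
    (tensorHom_comp_tensorHom := fun _ _ _ _ => hom_ext (TensorProduct.map_comp _ _ _ _).symm)
    (associator_naturality := fun _ _ _ => hom_ext (TensorProduct.ext_threefold fun _ _ _ => rfl))
    (leftUnitor_naturality := fun {M N} f => hom_ext (TensorProduct.ext' fun c m => by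
      change TensorProduct.lid k N.V (c ⊗ₜ Hom.lin f m) =
        Hom.lin f (TensorProduct.lid k M.V (c ⊗ₜ m))
      simp))
    (rightUnitor_naturality := fun {M N} f => hom_ext (TensorProduct.ext' fun m c => by
      change TensorProduct.rid k N.V (Hom.lin f m ⊗ₜ c) =
        Hom.lin f (TensorProduct.rid k M.V (m ⊗ₜ c))
      simp))
    (pentagon := fun W X Y Z => hom_ext (TensorProduct.ext_fourfold fun _ _ _ _ => rfl))
    (triangle := fun M N => hom_ext (TensorProduct.ext_threefold fun m c n => by
      change m ⊗ₜ TensorProduct.lid k N.V (c ⊗ₜ n) = TensorProduct.rid k M.V (m ⊗ₜ c) ⊗ₜ n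
      rw [TensorProduct.lid_tmul, TensorProduct.rid_tmul, TensorProduct.smul_tmul]))

instance : MonoidalPreadditive (FDMod k H) where
  whiskerLeft_zero := fun {_ _ _} => hom_ext (TensorProduct.map_zero_right _)
  zero_whiskerRight := fun {_ _ _} => hom_ext (TensorProduct.map_zero_left _)
  whiskerLeft_add := fun _ _ => hom_ext (TensorProduct.map_add_right _ _ _)
  add_whiskerRight := fun _ _ => hom_ext (TensorProduct.map_add_left _ _ _)

instance : MonoidalLinear k (FDMod k H) where
  whiskerLeft_smul := fun _ _ _ r _ => hom_ext (TensorProduct.map_smul_right r _ _)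
  smul_whiskerRight := fun r _ _ _ _ => hom_ext (TensorProduct.map_smul_left r _ _)

end Monoidal

end FDMod

/-- The Drinfeld double of a finite group, with basis `e g h` indexed by `G × G`. -/
def DrinfeldDouble (k : Type u) [Field k] (G : Type v) : Type (max u v) := G × G →₀ k

namespace DrinfeldDouble

section Basis

variable {k : Type u} [Field k] {G : Type v}

noncomputable instance : AddCommGroup (DrinfeldDouble k G) :=
  inferInstanceAs (AddCommGroup (G × G →₀ k))

noncomputable instance : Module k (DrinfeldDouble k G) :=
  inferInstanceAs (Module k (G × G →₀ k))

variable (k) in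
/-- The basis vector `e_g h`. -/
noncomputable def e (g h : G) : DrinfeldDouble k G := Finsupp.single (g, h) (1 : k)

/-- The linear map with prescribed values on the basis. -/
noncomputable def lift {W : Type w} [AddCommGroup W] [Module k W] (f : G → G → W) :
    DrinfeldDouble k G →ₗ[k] W :=
  Finsupp.linearCombination k fun p : G × G => f p.1 p.2

@[simp] theorem lift_e {W : Type w} [AddCommGroup W] [Module k W] (f : G → G → W) (g h : G) :
    lift f (e k g h) = f g h :=
  (Finsupp.linearCombination_single k (1 : k) (g, h)).trans (one_smul k _)

theorem induction {p : DrinfeldDouble k G → Prop} (x : DrinfeldDouble k G) (h0 : p 0)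
    (hadd : ∀ x y, p x → p y → p (x + y)) (hsmul : ∀ (c : k) x, p x → p (c • x))
    (he : ∀ g h, p (e k g h)) : p x := by
  refine Finsupp.induction_linear (motive := p) x h0 hadd fun q c => ?_
  have : (Finsupp.single q c : G × G →₀ k) = c • e k q.1 q.2 :=
    (congrArg (Finsupp.single q) (mul_one c).symm).trans (Finsupp.smul_single c q (1 : k)).symm
  exact this ▸ hsmul c _ (he q.1 q.2)

theorem lin_ext {W : Type w} [AddCommGroup W] [Module k W] {f f' : DrinfeldDouble k G →ₗ[k] W}
    (h : ∀ g h, f (e k g h) = f' (e k g h)) : f = f' := by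
  ext x
  induction x using induction with
  | h0 => simp
  | hadd x y hx hy => simp [hx, hy]
  | hsmul c x hx => simp [hx]
  | he a b => exact h a b

end Basis

variable {k : Type u} [Field k] {G : Type v} [Group G] [Fintype G] [DecidableEq G]

/-- The product, `(e_g h)(e_{g'} h') = δ_{g, h g' h⁻¹} e_g (h h')`. -/
noncomputable def mulLin :
    DrinfeldDouble k G →ₗ[k] DrinfeldDouble k G →ₗ[k] DrinfeldDouble k G :=
  lift fun g h => lift fun g' h' => if g = h * g' * h⁻¹ then e k g (h * h') else 0

noncomputable instance : Mul (DrinfeldDouble k G) := ⟨fun x y => mulLin x y⟩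

noncomputable instance : One (DrinfeldDouble k G) := ⟨∑ g, e k g 1⟩

theorem mul_eq (x y : DrinfeldDouble k G) : x * y = mulLin x y := rfl

theorem one_eq : (1 : DrinfeldDouble k G) = ∑ g, e k g 1 := rfl

theorem e_mul_e (g h g' h' : G) :
    e k g h * e k g' h' = if g = h * g' * h⁻¹ then e k g (h * h') else 0 := by
  simp [mul_eq, mulLin]

theorem mul_assoc_aux (x y z : DrinfeldDouble k G) : x * y * z = x * (y * z) := by
  induction x using induction with
  | h0 => simp [mul_eq]
  | hadd x x' hx hx' => simp only [mul_eq, map_add, LinearMap.add_apply] at *; rw [hx, hx']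
  | hsmul c x hx => simp only [mul_eq, map_smul, LinearMap.smul_apply] at *; rw [hx]
  | he g h =>
  induction y using induction with
  | h0 => simp [mul_eq]
  | hadd x x' hx hx' => simp only [mul_eq, map_add, LinearMap.add_apply] at *; rw [hx, hx']
  | hsmul c x hx => simp only [mul_eq, map_smul, LinearMap.smul_apply] at *; rw [hx]
  | he g' h' =>
  induction z using induction with
  | h0 => simp [mul_eq]
  | hadd x x' hx hx' => simp only [mul_eq, map_add, LinearMap.add_apply] at *; rw [hx, hx']
  | hsmul c x hx => simp only [mul_eq, map_smul, LinearMap.smul_apply] at *; rw [hx]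
  | he g'' h'' =>
  have z1 : ∀ x : DrinfeldDouble k G, 0 * x = 0 := fun x => by simp [mul_eq]
  have z2 : ∀ x : DrinfeldDouble k G, x * 0 = 0 := fun x => by simp [mul_eq]
  rw [e_mul_e, e_mul_e]
  by_cases h1 : g = h * g' * h⁻¹
  · by_cases h2 : g' = h' * g'' * h'⁻¹
    · rw [if_pos h1, if_pos h2, e_mul_e, e_mul_e, if_pos h1, if_pos, mul_assoc]
      rw [h1, h2]; group
    · rw [if_pos h1, if_neg h2, e_mul_e, if_neg, z2]
      intro h3
      apply h2
      rw [h1] at h3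
      have := congrArg (fun t => h⁻¹ * t * h) h3
      simpa [mul_assoc] using this
  · rw [if_neg h1, z1]
    by_cases h2 : g' = h' * g'' * h'⁻¹
    · rw [if_pos h2, e_mul_e, if_neg h1]
    · rw [if_neg h2, z2]

noncomputable instance : Ring (DrinfeldDouble k G) where
  left_distrib x y z := by simp [mul_eq]
  right_distrib x y z := by simp [mul_eq]
  zero_mul x := by simp [mul_eq]
  mul_zero x := by simp [mul_eq]
  mul_assoc := mul_assoc_aux
  one_mul x := by
    rw [mul_eq, one_eq]
    induction x using induction with
    | h0 => simp
    | hadd x y hx hy => simp only [map_add, hx, hy]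
    | hsmul c x hx => simp only [map_smul, hx]
    | he g h => simp [mulLin]
  mul_one x := by
    rw [mul_eq, one_eq]
    induction x using induction with
    | h0 => simp
    | hadd x y hx hy => simp only [map_add, LinearMap.add_apply, hx, hy]
    | hsmul c x hx => simp only [map_smul, LinearMap.smul_apply, hx]
    | he g h =>
      rw [map_sum, Finset.sum_eq_single (h⁻¹ * g * h)]
      · simp [mulLin, mul_assoc]
      · intro b _ hb
        have : g ≠ h * b * h⁻¹ := by
          rintro rfl; apply hb; group
        simp [mulLin, this]
      · simp
  zsmul := zsmulRec
  neg_add_cancel := neg_add_cancel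
  sub_eq_add_neg := sub_eq_add_neg

noncomputable instance : Algebra k (DrinfeldDouble k G) :=
  Algebra.ofModule (fun r x y => by simp [mul_eq]) (fun r x y => by simp [mul_eq])

/-- The coproduct, `Δ(e_g h) = ∑_{g₁ g₂ = g} e_{g₂} h ⊗ e_{g₁} h`. With this order of the two
factors (and not with the opposite one), `∑_g g ⊗ e_g` is a universal `R`-matrix. -/
noncomputable def comulLin : DrinfeldDouble k G →ₗ[k] DrinfeldDouble k G ⊗[k] DrinfeldDouble k G :=
  lift fun g h => ∑ a : G, e k (a⁻¹ * g) h ⊗ₜ e k a h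

/-- The counit, `ε(e_g h) = δ_{g,1}`. -/
noncomputable def counitLin : DrinfeldDouble k G →ₗ[k] k :=
  lift fun g _ => if g = 1 then 1 else 0

noncomputable instance : CoalgebraStruct k (DrinfeldDouble k G) where
  comul := comulLin
  counit := counitLin

theorem comul_e (g h : G) : Coalgebra.comul (R := k) (e k g h) =
    ∑ a : G, e k (a⁻¹ * g) h ⊗ₜ e k a h := lift_e _ g h

theorem counit_e (g h : G) : Coalgebra.counit (R := k) (e k g h) = if g = 1 then 1 else 0 :=
  lift_e _ g h

noncomputable instance : Coalgebra k (DrinfeldDouble k G) where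
  coassoc := lin_ext fun g h => by
    simp only [LinearMap.comp_apply, LinearEquiv.coe_coe, comul_e, map_sum,
      LinearMap.rTensor_tmul, LinearMap.lTensor_tmul, TensorProduct.sum_tmul,
      TensorProduct.tmul_sum, TensorProduct.assoc_tmul]
    conv_rhs => rw [Finset.sum_comm]
    refine Finset.sum_congr rfl fun a _ => Fintype.sum_equiv (Equiv.mulLeft a) _ _ fun b => ?_
    simp [mul_assoc]
  rTensor_counit_comp_comul := lin_ext fun g h => by
    simp only [LinearMap.comp_apply, comul_e, map_sum, LinearMap.rTensor_tmul, counit_e]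
    rw [Finset.sum_eq_single g]
    · simp
    · intro b _ hb
      rw [if_neg, TensorProduct.zero_tmul]
      intro h; exact hb (inv_mul_eq_one.1 h)
    · simp
  lTensor_counit_comp_comul := lin_ext fun g h => by
    simp only [LinearMap.comp_apply, comul_e, map_sum, LinearMap.lTensor_tmul, counit_e]
    rw [Finset.sum_eq_single 1]
    · simp
    · intro b _ hb
      rw [if_neg hb, TensorProduct.tmul_zero]
    · simp

/-- The coproduct is multiplicative on basis elements. -/
theorem comul_e_mul (g h g' h' : G) :
    Coalgebra.comul (R := k) (e k g h * e k g' h') =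
      Coalgebra.comul (R := k) (e k g h) * Coalgebra.comul (R := k) (e k g' h') := by
  rw [e_mul_e, comul_e, comul_e, Finset.sum_mul_sum]
  simp only [Algebra.TensorProduct.tmul_mul_tmul, e_mul_e]
  have key : ∀ a : G, (∑ b : G,
      (if a⁻¹ * g = h * (b⁻¹ * g') * h⁻¹ then e k (a⁻¹ * g) (h * h') else 0) ⊗ₜ[k]
        (if a = h * b * h⁻¹ then e k a (h * h') else 0)) =
      if g = h * g' * h⁻¹ then e k (a⁻¹ * g) (h * h') ⊗ₜ[k] e k a (h * h') else 0 := by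
    intro a
    rw [Finset.sum_eq_single (h⁻¹ * a * h)]
    · rw [if_pos (show a = h * (h⁻¹ * a * h) * h⁻¹ by group)]
      have : (a⁻¹ * g = h * ((h⁻¹ * a * h)⁻¹ * g') * h⁻¹) ↔ g = h * g' * h⁻¹ := by
        have : h * ((h⁻¹ * a * h)⁻¹ * g') * h⁻¹ = a⁻¹ * (h * g' * h⁻¹) := by group
        rw [this, mul_right_inj]
      simp only [this]
      split_ifs <;> simp
    · intro b _ hb
      rw [if_neg (c := a = h * b * h⁻¹), TensorProduct.tmul_zero]
      rintro rfl; apply hb; group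
    · simp
  rw [Finset.sum_congr rfl fun a _ => key a]
  split_ifs
  · rw [comul_e]
  · simp

theorem counit_e_mul (g h g' h' : G) :
    Coalgebra.counit (R := k) (e k g h * e k g' h') =
      Coalgebra.counit (R := k) (e k g h) * Coalgebra.counit (R := k) (e k g' h') := by
  rw [e_mul_e, counit_e, counit_e]
  by_cases h1 : g = h * g' * h⁻¹
  · rw [if_pos h1, counit_e]
    have : g = 1 ↔ g' = 1 := by rw [h1]; simp
    by_cases h2 : g' = 1
    · simp [h2, this.2 h2]
    · simp [h2, mt this.1 h2]
  · rw [if_neg h1, map_zero]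
    by_cases h2 : g = 1
    · have : g' ≠ 1 := by rintro rfl; apply h1; simp [h2]
      simp [this]
    · simp [h2]

noncomputable instance : Bialgebra k (DrinfeldDouble k G) :=
  Bialgebra.mk' k (DrinfeldDouble k G)
    (counit_one := by
      simp [one_eq, counit_e])
    (counit_mul := fun {x y} => by
      induction x using induction with
      | h0 => simp
      | hadd x x' hx hx' => simp only [add_mul, map_add, hx, hx']
      | hsmul c x hx => simp only [smul_mul_assoc, map_smul, hx]
      | he g h =>
      induction y using induction with
      | h0 => simp
      | hadd x x' hx hx' => simp only [mul_add, map_add, hx, hx']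
      | hsmul c x hx => simp only [mul_smul_comm, map_smul, hx]
      | he g' h' => exact counit_e_mul g h g' h')
    (comul_one := by
      simp only [one_eq, map_sum, comul_e]
      rw [Finset.sum_comm, Algebra.TensorProduct.one_def, one_eq, TensorProduct.tmul_sum]
      refine Finset.sum_congr rfl fun a _ => ?_
      rw [TensorProduct.sum_tmul]
      exact Fintype.sum_equiv (Equiv.mulLeft a⁻¹) _ _ fun b => rfl)
    (comul_mul := fun {x y} => by
      induction x using induction with
      | h0 => simp
      | hadd x x' hx hx' => simp only [add_mul, map_add, hx, hx']
      | hsmul c x hx => simp only [smul_mul_assoc, map_smul, hx]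
      | he g h =>
      induction y using induction with
      | h0 => simp
      | hadd x x' hx hx' => simp only [mul_add, map_add, hx, hx']
      | hsmul c x hx => simp only [mul_smul_comm, map_smul, hx]
      | he g' h' => exact comul_e_mul g h g' h')

/-- The antipode, `S(e_g h) = h⁻¹ e_{g⁻¹} = e_{h⁻¹ g⁻¹ h} h⁻¹`. -/
noncomputable instance : HopfAlgebraStruct k (DrinfeldDouble k G) where
  antipode := lift fun g h => e k (h⁻¹ * g⁻¹ * h) h⁻¹

theorem antipode_e (g h : G) :
    HopfAlgebraStruct.antipode k (e k g h) = e k (h⁻¹ * g⁻¹ * h) h⁻¹ := lift_e _ g h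

noncomputable instance : HopfAlgebra k (DrinfeldDouble k G) where
  mul_antipode_rTensor_comul := lin_ext fun g h => by
    simp only [LinearMap.comp_apply, comul_e, map_sum, LinearMap.rTensor_tmul, antipode_e,
      LinearMap.mul'_apply, counit_e, Algebra.linearMap_apply, e_mul_e]
    by_cases hg : g = 1
    · subst hg
      simp only [if_true, map_one, one_eq]
      refine Fintype.sum_equiv (MulAut.conj h⁻¹).toEquiv _ _ fun a => ?_
      simp
    · rw [if_neg hg, map_zero]
      refine Finset.sum_eq_zero fun a _ => if_neg fun h1 => hg ?_
      have := congrArg (fun t => h * t * h⁻¹ * a⁻¹) h1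
      simpa [mul_assoc] using this
  mul_antipode_lTensor_comul := lin_ext fun g h => by
    simp only [LinearMap.comp_apply, comul_e, map_sum, LinearMap.lTensor_tmul, antipode_e,
      LinearMap.mul'_apply, counit_e, Algebra.linearMap_apply, e_mul_e]
    by_cases hg : g = 1
    · subst hg
      simp only [if_true, map_one, one_eq]
      refine Fintype.sum_equiv (Equiv.inv G) _ _ fun a => ?_
      simp [mul_assoc]
    · rw [if_neg hg, map_zero]
      refine Finset.sum_eq_zero fun a _ => if_neg fun h1 => hg ?_
      have := congrArg (fun t => a * t) h1
      simpa [mul_assoc] using this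

variable (k) in
/-- The element `h = ∑_x e_x h` of the group `G`, seen in the Drinfeld double. -/
noncomputable def grp (h : G) : DrinfeldDouble k G := ∑ x, e k x h

theorem grp_one : grp k (1 : G) = 1 := rfl

theorem grp_mul_e (h g' h' : G) : grp k h * e k g' h' = e k (h * g' * h⁻¹) (h * h') := by
  simp [grp, Finset.sum_mul, e_mul_e]

theorem e_mul_grp (g h h' : G) : e k g h * grp k h' = e k g (h * h') := by
  rw [grp, Finset.mul_sum, Finset.sum_eq_single (h⁻¹ * g * h)]
  · rw [e_mul_e, if_pos (by group)]
  · intro b _ hb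
    rw [e_mul_e, if_neg]
    rintro rfl; apply hb; group
  · simp

theorem grp_mul_grp (h h' : G) : grp k h * grp k h' = grp k (h * h') := by
  have : grp k h = ∑ x, e k x h := rfl
  rw [this, Finset.sum_mul, Finset.sum_congr rfl fun x _ => e_mul_grp x h h']
  rfl

theorem e_one_mul_e_one (g g' : G) :
    e k g 1 * e k g' 1 = if g = g' then e k g 1 else 0 := by
  simp [e_mul_e]

theorem comul_grp (h : G) : Coalgebra.comul (R := k) (grp k h) = grp k h ⊗ₜ grp k h := by
  simp only [grp, map_sum, comul_e]
  rw [Finset.sum_comm, TensorProduct.tmul_sum]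
  refine Finset.sum_congr rfl fun a _ => ?_
  rw [TensorProduct.sum_tmul]
  exact Fintype.sum_equiv (Equiv.mulLeft a⁻¹) _ _ fun b => rfl

variable (k G) in
/-- The universal `R`-matrix `R = ∑_g g ⊗ e_g`. -/
noncomputable def rMatrix : DrinfeldDouble k G ⊗[k] DrinfeldDouble k G :=
  ∑ g : G, grp k g ⊗ₜ e k g 1

variable (k G) in
/-- The inverse of the universal `R`-matrix. -/
noncomputable def rMatrixInv : DrinfeldDouble k G ⊗[k] DrinfeldDouble k G :=
  ∑ g : G, grp k g⁻¹ ⊗ₜ e k g 1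

theorem rMatrix_mul_inv : rMatrix k G * rMatrixInv k G = 1 := by
  simp only [rMatrix, rMatrixInv, Finset.sum_mul_sum, Algebra.TensorProduct.tmul_mul_tmul,
    grp_mul_grp, e_one_mul_e_one]
  simp [TensorProduct.tmul_ite, grp_one, ← TensorProduct.tmul_sum, ← one_eq,
    Algebra.TensorProduct.one_def]

theorem rMatrixInv_mul : rMatrixInv k G * rMatrix k G = 1 := by
  simp only [rMatrix, rMatrixInv, Finset.sum_mul_sum, Algebra.TensorProduct.tmul_mul_tmul,
    grp_mul_grp, e_one_mul_e_one]
  simp [TensorProduct.tmul_ite, grp_one, ← TensorProduct.tmul_sum, ← one_eq,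
    Algebra.TensorProduct.one_def]

/-- The `R`-matrix conjugates the coproduct into the opposite coproduct. -/
theorem rMatrix_mul_comul (x : DrinfeldDouble k G) :
    rMatrix k G * Coalgebra.comul (R := k) x =
      TensorProduct.comm k _ _ (Coalgebra.comul (R := k) x) * rMatrix k G := by
  induction x using induction with
  | h0 => simp
  | hadd x y hx hy => simp only [map_add, mul_add, add_mul, hx, hy]
  | hsmul c x hx => simp only [map_smul, mul_smul_comm, smul_mul_assoc, hx]
  | he x h =>
    have l : rMatrix k G * Coalgebra.comul (R := k) (e k x h) =
        ∑ a : G, e k (x * a⁻¹) (a * h) ⊗ₜ[k] e k a h := by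
      rw [comul_e, rMatrix, Finset.sum_mul_sum]
      simp only [Algebra.TensorProduct.tmul_mul_tmul, grp_mul_e, e_mul_e]
      simp [TensorProduct.tmul_ite, mul_assoc]
    have r : TensorProduct.comm k _ _ (Coalgebra.comul (R := k) (e k x h)) * rMatrix k G =
        ∑ a : G, e k a (a⁻¹ * x * h) ⊗ₜ[k] e k (a⁻¹ * x) h := by
      rw [comul_e, rMatrix, map_sum, Finset.sum_mul_sum]
      refine Finset.sum_congr rfl fun a _ => ?_
      simp only [TensorProduct.comm_tmul, Algebra.TensorProduct.tmul_mul_tmul, e_mul_grp, e_mul_e]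
      rw [Finset.sum_eq_single (h⁻¹ * (a⁻¹ * x) * h)]
      · rw [if_pos (by group)]; simp [mul_assoc]
      · intro b _ hb
        rw [if_neg, TensorProduct.tmul_zero]
        intro h1; apply hb; rw [h1]; group
      · simp
    rw [l, r]
    refine Fintype.sum_equiv ((Equiv.inv G).trans (Equiv.mulLeft x)) _ _ fun a => ?_
    simp [mul_assoc]

variable (k G) in
/-- The element `∑_g e_g g`, the inverse of the Drinfeld element `∑_g S(e_g) g`. -/
noncomputable def twistElt : DrinfeldDouble k G := ∑ g, e k g g

variable (k G) in
/-- The Drinfeld element `∑_g S(e_g) g = ∑_g e_g g⁻¹`. -/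
noncomputable def drinfeldElt : DrinfeldDouble k G := ∑ g, e k g g⁻¹

theorem twistElt_mul_e (g h : G) : twistElt k G * e k g h = e k g (g * h) := by
  rw [twistElt, Finset.sum_mul, Finset.sum_eq_single g]
  · simp [e_mul_e]
  · intro b _ hb
    rw [e_mul_e, if_neg]
    intro h; apply hb
    have := congrArg (fun t => b⁻¹ * t * b) h
    simpa [mul_assoc] using this
  · simp

theorem e_mul_twistElt (g h : G) : e k g h * twistElt k G = e k g (g * h) := by
  rw [twistElt, Finset.mul_sum, Finset.sum_eq_single (h⁻¹ * g * h)]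
  · rw [e_mul_e, if_pos (by group)]; congr 1; group
  · intro b _ hb
    rw [e_mul_e, if_neg]
    rintro rfl; apply hb; group
  · simp

theorem twistElt_comm (x : DrinfeldDouble k G) : twistElt k G * x = x * twistElt k G := by
  induction x using induction with
  | h0 => simp
  | hadd x y hx hy => simp only [mul_add, add_mul, hx, hy]
  | hsmul c x hx => simp only [mul_smul_comm, smul_mul_assoc, hx]
  | he g h => rw [twistElt_mul_e, e_mul_twistElt]

theorem twistElt_mul_drinfeldElt : twistElt k G * drinfeldElt k G = 1 := by
  rw [drinfeldElt, Finset.mul_sum]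
  simp [twistElt_mul_e, one_eq]

theorem drinfeldElt_mul_twistElt : drinfeldElt k G * twistElt k G = 1 := by
  rw [← twistElt_comm, twistElt_mul_drinfeldElt]

/-- `Δ(θ) = (θ ⊗ θ) R₂₁ R`. -/
theorem comul_twistElt : Coalgebra.comul (R := k) (twistElt k G) =
    (twistElt k G ⊗ₜ twistElt k G) * (TensorProduct.comm k _ _ (rMatrix k G) * rMatrix k G) := by
  have h1 : TensorProduct.comm k _ _ (rMatrix k G) * rMatrix k G =
      ∑ a : G, ∑ b : G, e k a b ⊗ₜ[k] e k (a * b * a⁻¹) a := by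
    simp only [rMatrix, map_sum, TensorProduct.comm_tmul, Finset.sum_mul_sum,
      Algebra.TensorProduct.tmul_mul_tmul, e_mul_grp, grp_mul_e, one_mul, mul_one]
  rw [h1]
  simp only [Finset.mul_sum, Algebra.TensorProduct.tmul_mul_tmul, twistElt_mul_e]
  simp only [twistElt, map_sum, comul_e]
  rw [← Fintype.sum_prod_type', ← Fintype.sum_prod_type']
  refine Fintype.sum_equiv
    { toFun := fun p => (p.2⁻¹ * p.1, p.1⁻¹ * p.2 * p.1)
      invFun := fun q => (q.1 * q.2, q.1 * q.2 * q.1⁻¹)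
      left_inv := fun p => by ext <;> simp [mul_assoc]
      right_inv := fun q => by ext <;> simp [mul_assoc] } _ _ fun p => ?_
  simp [mul_assoc]

end DrinfeldDouble

section Braiding

variable {k : Type u} [Field k] {G : Type v} [Group G] [Fintype G] [DecidableEq G]

variable (k G) in
/-- The category of finite-dimensional modules over the Drinfeld double of `G`. -/
abbrev DGMod : Type (max (u + 1) u v) := FDMod k (DrinfeldDouble k G)

namespace DGMod

open DrinfeldDouble FDMod

theorem comm_act₂ (M N : DGMod k G) (t : DrinfeldDouble k G ⊗[k] DrinfeldDouble k G)
    (z : M.V ⊗[k] N.V) :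
    TensorProduct.comm k M.V N.V (act₂ M N t z) =
      act₂ N M (TensorProduct.comm k _ _ t) (TensorProduct.comm k M.V N.V z) := by
  induction t with
  | zero => simp
  | add s t hs ht => simp only [map_add, LinearMap.add_apply, hs, ht]
  | tmul x y =>
    induction z with
    | zero => simp
    | add z z' hz hz' => simp only [map_add, hz, hz']
    | tmul m n => simp

theorem comm_comm (t : DrinfeldDouble k G ⊗[k] DrinfeldDouble k G) :
    TensorProduct.comm k _ _ (TensorProduct.comm k _ _ t) = t :=
  (TensorProduct.comm k _ _).symm_apply_apply t

/-- The action of the `R`-matrix on a tensor product. -/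
noncomputable def rEquiv (M N : DGMod k G) : (M.V ⊗[k] N.V) ≃ₗ[k] (M.V ⊗[k] N.V) :=
  LinearEquiv.ofLinearMap (act₂ M N (rMatrix k G)) (act₂ M N (rMatrixInv k G))
    (by rw [← Module.End.mul_eq_comp, ← map_mul, rMatrix_mul_inv, map_one]; rfl)
    (by rw [← Module.End.mul_eq_comp, ← map_mul, rMatrixInv_mul, map_one]; rfl)

/-- The braiding: the action of the `R`-matrix followed by the flip. -/
noncomputable def braid (M N : DGMod k G) : M ⊗ N ≅ N ⊗ M :=
  isoMk ((rEquiv M N).trans (TensorProduct.comm k M.V N.V)) fun x z => by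
    change TensorProduct.comm k M.V N.V (act₂ M N (rMatrix k G)
        (act₂ M N (Coalgebra.comul (R := k) x) z)) =
      act₂ N M (Coalgebra.comul (R := k) x) (TensorProduct.comm k M.V N.V
        (act₂ M N (rMatrix k G) z))
    rw [← Module.End.mul_apply, ← map_mul, rMatrix_mul_comul, map_mul, Module.End.mul_apply,
      comm_act₂, comm_comm]

theorem braid_hom_apply (M N : DGMod k G) (z : M.V ⊗[k] N.V) :
    Hom.lin (braid M N).hom z = TensorProduct.comm k M.V N.V (act₂ M N (rMatrix k G) z) := rfl

theorem braid_tmul (M N : DGMod k G) (m : M.V) (n : N.V) :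
    Hom.lin (braid M N).hom (m ⊗ₜ n) = ∑ g : G, N.act (e k g 1) n ⊗ₜ M.act (grp k g) m := by
  simp [braid_hom_apply, rMatrix, LinearMap.sum_apply]

theorem act_grp_tmul (M N : DGMod k G) (g : G) (m : M.V) (n : N.V) :
    (M ⊗ N).act (grp k g) (m ⊗ₜ[k] n) = M.act (grp k g) m ⊗ₜ N.act (grp k g) n := by
  change act₂ M N (Coalgebra.comul (R := k) (grp k g)) (m ⊗ₜ n) = _
  rw [comul_grp, act₂_tmul]

theorem act_e_tmul (M N : DGMod k G) (g h : G) (m : M.V) (n : N.V) :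
    (M ⊗ N).act (e k g h) (m ⊗ₜ[k] n) =
      ∑ a : G, M.act (e k (a⁻¹ * g) h) m ⊗ₜ N.act (e k a h) n := by
  change act₂ M N (Coalgebra.comul (R := k) (e k g h)) (m ⊗ₜ n) = _
  rw [comul_e, map_sum, LinearMap.sum_apply]
  rfl

theorem act_grp_grp (M : DGMod k G) (g h : G) (m : M.V) :
    M.act (grp k g) (M.act (grp k h) m) = M.act (grp k (g * h)) m := by
  rw [← Module.End.mul_apply, ← map_mul, grp_mul_grp]

theorem act_e_e (M : DGMod k G) (g h : G) (m : M.V) :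
    M.act (e k g 1) (M.act (e k h 1) m) = if g = h then M.act (e k g 1) m else 0 := by
  rw [← Module.End.mul_apply, ← map_mul, e_one_mul_e_one]
  split_ifs <;> simp

noncomputable instance : BraidedCategory (DGMod k G) where
  braiding := braid
  braiding_naturality_right X Y Z f := hom_ext (TensorProduct.ext' fun m n => by
    change Hom.lin (braid X Z).hom (m ⊗ₜ Hom.lin f n) =
      TensorProduct.map (Hom.lin f) LinearMap.id (Hom.lin (braid X Y).hom (m ⊗ₜ n))
    simp [braid_tmul, Hom.comm f])
  braiding_naturality_left {X Y} f Z := hom_ext (TensorProduct.ext' fun m n => by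
    change Hom.lin (braid Y Z).hom (Hom.lin f m ⊗ₜ n) =
      TensorProduct.map LinearMap.id (Hom.lin f) (Hom.lin (braid X Z).hom (m ⊗ₜ n))
    simp [braid_tmul, Hom.comm f])
  hexagon_forward X Y Z := hom_ext (TensorProduct.ext_threefold fun x y z => by
    have h1 : Hom.lin (braid X (Y ⊗ Z)).hom (x ⊗ₜ (y ⊗ₜ[k] z)) =
        (∑ g : G, ∑ a : G, (Y.act (e k (a⁻¹ * g) 1) y ⊗ₜ[k] Z.act (e k a 1) z) ⊗ₜ[k]
          X.act (grp k g) x : (Y.V ⊗[k] Z.V) ⊗[k] X.V) := by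
      rw [braid_tmul]
      refine Finset.sum_congr rfl fun g _ => ?_
      rw [act_e_tmul]
      exact TensorProduct.sum_tmul _ _ _
    have h2 : TensorProduct.map LinearMap.id (Hom.lin (braid X Z).hom)
        (TensorProduct.assoc k Y.V X.V Z.V
          (TensorProduct.map (Hom.lin (braid X Y).hom) LinearMap.id ((x ⊗ₜ y) ⊗ₜ[k] z))) =
        (∑ g : G, ∑ a : G, Y.act (e k g 1) y ⊗ₜ[k] (Z.act (e k a 1) z ⊗ₜ[k]
          X.act (grp k (a * g)) x) : Y.V ⊗[k] (Z.V ⊗[k] X.V)) := by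
      have h3 : TensorProduct.map (Hom.lin (braid X Y).hom) LinearMap.id ((x ⊗ₜ y) ⊗ₜ[k] z) =
          (∑ g : G, (Y.act (e k g 1) y ⊗ₜ[k] X.act (grp k g) x) ⊗ₜ[k] z :
            (Y.V ⊗[k] X.V) ⊗[k] Z.V) := by
        rw [TensorProduct.map_tmul, braid_tmul]
        exact TensorProduct.sum_tmul _ _ _
      rw [h3]
      simp only [map_sum]
      refine Finset.sum_congr rfl fun g _ => ?_
      rw [TensorProduct.assoc_tmul, TensorProduct.map_tmul, braid_tmul]
      simp only [act_grp_grp]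
      exact TensorProduct.tmul_sum _ _ _
    change TensorProduct.assoc k Y.V Z.V X.V
        (Hom.lin (braid X (Y ⊗ Z)).hom (x ⊗ₜ (y ⊗ₜ[k] z))) = _
    rw [h1]
    refine Eq.trans ?_ h2.symm
    simp only [map_sum, TensorProduct.assoc_tmul]
    rw [Finset.sum_comm]
    conv_rhs => rw [Finset.sum_comm]
    refine Finset.sum_congr rfl fun a _ => Fintype.sum_equiv (Equiv.mulLeft a⁻¹) _ _ fun b => ?_
    simp)
  hexagon_reverse X Y Z := hom_ext (TensorProduct.ext_threefold' fun x y z => by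
    have h1 : Hom.lin (braid (X ⊗ Y) Z).hom ((x ⊗ₜ[k] y) ⊗ₜ z) =
        (∑ g : G, Z.act (e k g 1) z ⊗ₜ[k] (X.act (grp k g) x ⊗ₜ[k] Y.act (grp k g) y) :
          Z.V ⊗[k] (X.V ⊗[k] Y.V)) := by
      rw [braid_tmul]
      refine Finset.sum_congr rfl fun g _ => ?_
      rw [act_grp_tmul]
    have h2 : TensorProduct.map (Hom.lin (braid X Z).hom) LinearMap.id
        ((TensorProduct.assoc k X.V Z.V Y.V).symm
          (TensorProduct.map LinearMap.id (Hom.lin (braid Y Z).hom) (x ⊗ₜ[k] (y ⊗ₜ z)))) =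
        (∑ g : G, (Z.act (e k g 1) z ⊗ₜ[k] X.act (grp k g) x) ⊗ₜ[k] Y.act (grp k g) y :
          (Z.V ⊗[k] X.V) ⊗[k] Y.V) := by
      have h3 : TensorProduct.map LinearMap.id (Hom.lin (braid Y Z).hom) (x ⊗ₜ[k] (y ⊗ₜ z)) =
          (∑ g : G, x ⊗ₜ[k] (Z.act (e k g 1) z ⊗ₜ[k] Y.act (grp k g) y) :
            X.V ⊗[k] (Z.V ⊗[k] Y.V)) := by
        rw [TensorProduct.map_tmul, braid_tmul]
        exact TensorProduct.tmul_sum _ _ _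
      rw [h3]
      simp only [map_sum]
      refine Finset.sum_congr rfl fun g _ => ?_
      rw [TensorProduct.assoc_symm_tmul, TensorProduct.map_tmul, braid_tmul]
      simp only [act_e_e]
      rw [Finset.sum_eq_single g]
      · simp
      · intro b _ hb
        rw [if_neg hb, TensorProduct.zero_tmul]
      · simp
    change (TensorProduct.assoc k Z.V X.V Y.V).symm
        (Hom.lin (braid (X ⊗ Y) Z).hom ((x ⊗ₜ[k] y) ⊗ₜ z)) = _
    rw [h1]
    refine Eq.trans ?_ h2.symm
    simp only [map_sum, TensorProduct.assoc_symm_tmul])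

end DGMod

end Braiding

section Ribbon

open Limits

variable {C : Type u} [Category.{v} C] [MonoidalCategory C] [BraidedCategory C]

variable (C) in
/-- A twist on a braided category: a natural automorphism `θ` of the identity functor with
`θ_{X ⊗ Y} = (θ_X ⊗ θ_Y) ∘ c_{Y,X} ∘ c_{X,Y}`. -/
structure Twist where
  iso : ∀ X : C, X ≅ X
  naturality : ∀ {X Y : C} (f : X ⟶ Y), f ≫ (iso Y).hom = (iso X).hom ≫ f
  tensor : ∀ X Y : C, (iso (X ⊗ Y)).hom =
    (β_ X Y).hom ≫ (β_ Y X).hom ≫ ((iso X).hom ⊗ₘ (iso Y).hom)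

namespace Twist

/-- The restriction of a twist to a full monoidal subcategory. -/
def restrict (θ : Twist C) (P : ObjectProperty C) [P.IsMonoidal] : Twist P.FullSubcategory where
  iso X := P.isoMk (θ.iso X.obj)
  naturality f := ObjectProperty.hom_ext P (θ.naturality f.hom)
  tensor X Y := ObjectProperty.hom_ext P (θ.tensor X.obj Y.obj)

/-- The dual `X*` of `X`, with evaluation `ε_ X X* : X* ⊗ X ⟶ 𝟙` and coevaluation
`η_ X X* : 𝟙 ⟶ X ⊗ X*`; this is called the right dual in Mathlib. -/
abbrev du [RightRigidCategory C] (X : C) : C := HasRightDual.rightDual X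

/-- The Drinfeld morphism `u_X : X ⟶ X**`. -/
def drinfeld [RightRigidCategory C] (X : C) : X ⟶ du (du X) :=
  (ρ_ X).inv ≫ X ◁ η_ (du X) (du (du X)) ≫ (α_ X (du X) (du (du X))).inv ≫
    (β_ X (du X)).hom ▷ du (du X) ≫ ε_ X (du X) ▷ du (du X) ≫ (λ_ (du (du X))).hom

/-- The pivotal structure `a = u ∘ θ` corresponding to a twist `θ`. -/
def pivot (θ : Twist C) [RightRigidCategory C] (X : C) : X ⟶ du (du X) :=
  (θ.iso X).hom ≫ drinfeld X

/-- The right quantum trace of an endomorphism, as an endomorphism of the unit object. -/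
def traceR (θ : Twist C) [RightRigidCategory C] {X : C} (f : X ⟶ X) : 𝟙_ C ⟶ 𝟙_ C :=
  η_ X (du X) ≫ (f ≫ θ.pivot X) ▷ du X ≫ ε_ (du X) (du (du X))

/-- The left quantum trace of an endomorphism; `b` is the inverse of the pivotal structure. -/
def traceL [RightRigidCategory C] {X : C} (b : du (du X) ⟶ X) (f : X ⟶ X) : 𝟙_ C ⟶ 𝟙_ C :=
  η_ (du X) (du (du X)) ≫ du X ◁ (b ≫ f) ≫ ε_ X (du X)

/-- The pivotal structure corresponding to the twist is spherical: it consists of isomorphisms,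
and left and right quantum traces agree. -/
def IsSpherical (θ : Twist C) [RightRigidCategory C] : Prop :=
  ∀ X : C, ∃ a : X ≅ du (du X), a.hom = θ.pivot X ∧ ∀ f : X ⟶ X, θ.traceR f = traceL a.inv f

end Twist

/-- A fusion category over `k`: a `k`-linear abelian monoidal category with bilinear tensor product
that is rigid and semisimple, with finite-dimensional spaces of morphisms, finitely many simple
objects up to isomorphism, and a simple unit object. -/
structure IsFusion (k : Type w) [Field k] (C : Type u) [Category.{v} C] [MonoidalCategory C]
    [Preadditive C] [Linear k C] : Prop where
  [hasFiniteBiproducts : HasFiniteBiproducts C]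
  hasKernels : HasKernels C
  hasCokernels : HasCokernels C
  normalMono : IsNormalMonoCategory C
  normalEpi : IsNormalEpiCategory C
  [monoidalPreadditive : MonoidalPreadditive C]
  monoidalLinear : MonoidalLinear k C
  finite_hom : ∀ X Y : C, Module.Finite k (X ⟶ Y)
  semisimple : ∀ X : C, ∃ (n : ℕ) (Y : Fin n → C),
    (∀ i, Simple (Y i)) ∧ Nonempty (X ≅ ⨁ Y)
  finite_simple : ∃ (n : ℕ) (Y : Fin n → C), ∀ X : C, Simple X → ∃ i, Nonempty (X ≅ Y i)
  simple_unit : Simple (𝟙_ C)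
  rigid : Nonempty (RigidCategory C)

/-- A premodular category: a braided fusion category with a twist whose pivotal structure is
spherical. Quantum traces do not depend on the choice of duals. -/
structure IsPremodular (k : Type w) [Field k] [Preadditive C] [Linear k C] (θ : Twist C) :
    Prop where
  fusion : IsFusion k C
  spherical : ∃ _ : RightRigidCategory C, θ.IsSpherical

/-- A modular category: a premodular category whose `S`-matrix
`S_{X,Y} = tr(c_{Y,X} ∘ c_{X,Y})`, indexed by the isomorphism classes of simple objects, is
invertible. -/
structure IsModular (k : Type w) [Field k] [Preadditive C] [Linear k C] (θ : Twist C) : Prop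
    extends IsPremodular k θ where
  nondegenerate : ∃ (_ : RightRigidCategory C) (n : ℕ) (X : Fin n → C)
      (S : Matrix (Fin n) (Fin n) k),
    (∀ i, Simple (X i)) ∧ (∀ i j, Nonempty (X i ≅ X j) → i = j) ∧
    (∀ Y : C, Simple Y → ∃ i, Nonempty (Y ≅ X i)) ∧
    (∀ i j, θ.traceR ((β_ (X i) (X j)).hom ≫ (β_ (X j) (X i)).hom) = S i j • 𝟙 (𝟙_ C)) ∧
    IsUnit S.det

/-- `F : C ⥤ D` is a modularization of the premodular category `C`: the category `D` is modular,
and `F` is a `k`-linear braided (strong) monoidal functor that preserves the twist and is dominant,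
that is, every object of `D` is a direct summand of an object in the image of `F`. -/
structure IsModularization (k : Type w) [Field k] [Preadditive C] [Linear k C]
    {D : Type*} [Category D] [MonoidalCategory D] [BraidedCategory D] [Preadditive D] [Linear k D]
    (θC : Twist C) (θD : Twist D) (F : C ⥤ D) [F.Braided] : Prop where
  premodular : IsPremodular k θC
  modular : IsModular k θD
  additive : F.Additive
  linear : F.Linear k
  twist : ∀ X : C, F.map (θC.iso X).hom = (θD.iso (F.obj X)).hom
  dominant : ∀ Y : D, ∃ X : C, Nonempty (Retract Y (F.obj X))

end Ribbon

section Double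

variable {k : Type u} [Field k] {G : Type v} [Group G] [Fintype G] [DecidableEq G]

namespace DGMod

open DrinfeldDouble FDMod

variable (k G) in
/-- The twist on `D(G)`-modules, the action of `∑_g e_g g`. As the Drinfeld morphism is the action
of the inverse element `∑_g e_g g⁻¹` followed by the usual identification of a vector space with
its bidual, this is the twist corresponding to the latter as pivotal structure. -/
noncomputable def twist : Twist (DGMod k G) where
  iso M := isoMk (LinearEquiv.ofLinearMap (M.act (twistElt k G)) (M.act (drinfeldElt k G))
      (by rw [← Module.End.mul_eq_comp, ← map_mul, twistElt_mul_drinfeldElt, map_one]; rfl)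
      (by rw [← Module.End.mul_eq_comp, ← map_mul, drinfeldElt_mul_twistElt, map_one]; rfl))
    fun x m => by
      change M.act (twistElt k G) (M.act x m) = M.act x (M.act (twistElt k G) m)
      rw [← Module.End.mul_apply, ← map_mul, twistElt_comm, map_mul, Module.End.mul_apply]
  naturality {M N} f := hom_ext (LinearMap.ext fun m => (Hom.comm f (twistElt k G) m).symm)
  tensor M N := hom_ext (LinearMap.ext fun z => by
    change act₂ M N (Coalgebra.comul (R := k) (twistElt k G)) z =
      act₂ M N (twistElt k G ⊗ₜ twistElt k G) (TensorProduct.comm k N.V M.V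
        (act₂ N M (rMatrix k G) (TensorProduct.comm k M.V N.V (act₂ M N (rMatrix k G) z))))
    rw [comul_twistElt, map_mul, map_mul, Module.End.mul_apply, Module.End.mul_apply, comm_act₂]
    congr 2
    exact ((TensorProduct.comm k M.V N.V).symm_apply_apply _).symm)

/-- The subspace `e_g X` of a `D(G)`-module. -/
noncomputable def degreeSpace (X : DGMod k G) (g : G) : Submodule k X.V :=
  LinearMap.range (X.act (e k g 1))

/-- The representation of the centralizer `Z_G(g)` on `e_g X`. The simple `D(G)`-module `V_{g,ρ}`
is the one for which this is isomorphic to the irreducible representation `ρ`. -/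
noncomputable def centralizerRep (X : DGMod k G) (g : G) :
    Representation k (Subgroup.centralizer {g}) (X.degreeSpace g) where
  toFun h := (X.act (grp k (h : G))).restrict (by
    rintro _ ⟨x, rfl⟩
    refine ⟨X.act (grp k (h : G)) x, ?_⟩
    rw [← Module.End.mul_apply, ← Module.End.mul_apply, ← map_mul, ← map_mul, grp_mul_e,
      e_mul_grp]
    have := Subgroup.mem_centralizer_singleton_iff.1 h.2
    rw [this]; simp)
  map_one' := by ext x; simp [grp_one]
  map_mul' a b := by ext x; simp [act_grp_grp]

/-- The character of `D(G)` given by a central element `z`, sending `e_g h` to `δ_{g,z}`. -/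
noncomputable def centralChar (z : Subgroup.center G) : DrinfeldDouble k G →ₐ[k] k :=
  AlgHom.ofLinearMap (lift fun g _ => if g = (z : G) then 1 else 0)
    (by simp [one_eq])
    fun x y => by
      induction x using induction with
      | h0 => simp
      | hadd x x' hx hx' => simp only [add_mul, map_add, hx, hx']
      | hsmul c x hx => simp only [smul_mul_assoc, map_smul, hx]
      | he g h =>
      induction y using induction with
      | h0 => simp
      | hadd x x' hx hx' => simp only [mul_add, map_add, hx, hx']
      | hsmul c x hx => simp only [mul_smul_comm, map_smul, hx]
      | he g' h' =>
        have hz : ∀ x : G, x * z = z * x := fun x => Subgroup.mem_center_iff.1 z.2 x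
        rw [e_mul_e, lift_e, lift_e]
        by_cases h1 : g = h * g' * h⁻¹
        · rw [if_pos h1, lift_e]
          have : g = z ↔ g' = z := by
            rw [h1, mul_inv_eq_iff_eq_mul, ← hz, mul_right_inj]
          by_cases h2 : g' = z
          · simp [h2, this.2 h2]
          · simp [h2, mt this.1 h2]
        · rw [if_neg h1, map_zero]
          by_cases h2 : g' = z
          · have : g ≠ z := by
              rintro h3; apply h1; rw [h2, h3, hz, mul_inv_cancel_right]
            simp [this]
          · simp [h2]

@[simp] theorem centralChar_e (z : Subgroup.center G) (g h : G) :
    centralChar z (e k g h) = if g = (z : G) then 1 else 0 :=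
  lift_e (fun g _ => if g = (z : G) then (1 : k) else 0) g h

theorem centralChar_grp (z : Subgroup.center G) (h : G) : centralChar z (grp k h) = 1 := by
  simp [grp]

variable (k) in
/-- The one-dimensional `D(G)`-module `V_{z,1}` for a central element `z`. -/
noncomputable def central (z : Subgroup.center G) : DGMod k G where
  V := k
  act := (Algebra.lmul k k).comp (centralChar z)

variable {A : Type w} [Group A]

/-- The component of degree `α` of the category of `D(G)`-modules, for a group `A` mapping to the
center of `G`: the full subcategory of the objects whose double braiding with `V_{a,1}` is
`α(a) id` for all `a` in `A`. -/
def component (ι : A →* Subgroup.center G) (α : A →* kˣ) : ObjectProperty (DGMod k G) :=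
  fun X => ∀ a : A, (β_ (central k (ι a)) X).hom ≫ (β_ X (central k (ι a))).hom =
    (α a : k) • 𝟙 (central k (ι a) ⊗ X)

theorem doubleBraiding_central (z : Subgroup.center G) (X : DGMod k G) (c : k) (x : X.V) :
    Hom.lin ((β_ (central k z) X).hom ≫ (β_ X (central k z)).hom) (c ⊗ₜ[k] x : k ⊗[k] X.V) =
      (c ⊗ₜ[k] X.act (grp k (z : G)) x : k ⊗[k] X.V) := by
  have h1 : Hom.lin (braid (central k z) X).hom (c ⊗ₜ[k] x : k ⊗[k] X.V) =
      (x ⊗ₜ[k] c : X.V ⊗[k] k) := by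
    refine (braid_tmul (central k z) X c x).trans ?_
    have : ∀ g : G, (central k z).act (grp k g) c = c := fun g => by
      change centralChar z (grp k g) * c = c
      rw [centralChar_grp, one_mul]
    simp only [this]
    refine (TensorProduct.sum_tmul _ _ _).symm.trans ?_
    rw [← LinearMap.sum_apply, ← map_sum, ← one_eq, map_one]
    rfl
  have h2 : Hom.lin (braid X (central k z)).hom (x ⊗ₜ[k] c : X.V ⊗[k] k) =
      (c ⊗ₜ[k] X.act (grp k (z : G)) x : k ⊗[k] X.V) := by
    refine (braid_tmul X (central k z) x c).trans ?_
    have : ∀ g : G, (central k z).act (e k g 1) c = if g = z then c else 0 := fun g => by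
      change centralChar z (e k g 1) * c = _
      rw [centralChar_e]; split_ifs <;> simp
    simp only [this]
    rw [Finset.sum_eq_single (z : G)]
    · rw [if_pos rfl]; rfl
    · intro b _ hb
      rw [if_neg hb]; exact TensorProduct.zero_tmul _ _
    · simp
  change Hom.lin (braid X (central k z)).hom (Hom.lin (braid (central k z) X).hom _) = _
  rw [h1, h2]

theorem component_iff (ι : A →* Subgroup.center G) (α : A →* kˣ) (X : DGMod k G) :
    component ι α X ↔ ∀ (a : A) (x : X.V), X.act (grp k (ι a : G)) x = (α a : k) • x := by
  refine forall_congr' fun a => ⟨fun h x => ?_, fun h => ?_⟩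
  · have h1 := congrArg (fun f => TensorProduct.lid k X.V (Hom.lin f ((1 : k) ⊗ₜ[k] x))) h
    simp only [doubleBraiding_central] at h1
    change TensorProduct.lid k X.V ((1 : k) ⊗ₜ[k] X.act (grp k (ι a : G)) x) =
      TensorProduct.lid k X.V ((α a : k) • ((1 : k) ⊗ₜ[k] x)) at h1
    simpa using h1
  · refine hom_ext (TensorProduct.ext' fun c x => ?_)
    refine (doubleBraiding_central (ι a) X c x).trans ?_
    rw [h]
    change c ⊗ₜ[k] ((α a : k) • x) = (α a : k) • (c ⊗ₜ[k] x)
    simp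

instance (ι : A →* Subgroup.center G) :
    (component ι (1 : A →* kˣ)).IsMonoidal where
  prop_unit := (component_iff _ _ _).2 fun a x => by
    change Coalgebra.counit (R := k) (grp k (ι a : G)) * x = _
    simp [grp, counit_e]
  prop_tensor X Y hX hY := by
    rw [component_iff] at hX hY ⊢
    intro a z
    change act₂ X Y (Coalgebra.comul (R := k) (grp k (ι a : G))) z = _
    rw [comul_grp]
    have h : act₂ X Y (grp k (ι a : G) ⊗ₜ grp k (ι a : G)) = LinearMap.id :=
      TensorProduct.ext' fun x y => by
        rw [act₂_tmul, hX, hY]; simp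
    rw [h]; simp

/-- The inclusion of the kernel of a central extension into the center. -/
def centralInl {E Q : Type*} [Group E] [Group Q] (S : GroupExtension A E Q)
    (hS : S.inl.range ≤ Subgroup.center E) : A →* Subgroup.center E :=
  S.inl.codRestrict (Subgroup.center E) fun a => hS ⟨a, rfl⟩

/-- A central element, seen in the centralizer of an element. -/
def toCentralizer {E : Type*} [Group E] (z : Subgroup.center E) (g : E) :
    Subgroup.centralizer {g} :=
  ⟨z, Subgroup.center_le_centralizer _ z.2⟩

end DGMod

end Double

/-! Grading. The double braiding of `V_{a,1}` with `X` is the action of the group element `a` on `X`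
(`component_iff`). As `a` is central in the extension `E`, this element is central in `D(E)`
(`grp_center_comm`), so by Schur's lemma it acts on a simple module by a scalar, and these scalars
form a character of `A`. It is also group-like, so the characters multiply under tensor products. A
scalar can be read off on any nonzero `e_g X`, which gives the description by centralizers.

Premodularity. Full subcategories of modules closed under submodules, quotients and direct sums
inherit kernels, cokernels and biproducts from vector spaces (`IsExactEmbedding`). Semisimplicity
comes from averaging over the double (`hasSplitting`). The twist cancels the Drinfeld element, so
the pivotal structure is the usual map to the bidual and both quantum traces are ordinary traces
(`pivot_apply`, `traceR_eq`, `traceL_eq`).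

Modularity. Entries of the `S`-matrix are values of products of characters on `R₂₁ R`. A vector `v`
in its kernel gives a trace form `f = ∑ v_j χ_j`. Its image under the Drinfeld map is central
(`drinfeldMap_mul`) and killed by every simple character, hence zero
(`eq_zero_of_char_simple_eq_zero`). The Drinfeld map is injective on trace forms
(`eq_zero_of_drinfeldMap_eq_zero`), so `f = 0`, and orthogonality of characters gives `v = 0`.

Modularization. In trivial degree `A` acts trivially, so `E` acts through `G`, and the `E`-grading
can be coarsened to a `G`-grading. This does not change the underlying space. Tensor products,
braiding and twist are respected because each is a sum over group elements that can be grouped by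
fibres of `E → G`. Dominance holds because a `D(G)`-module `Y` is a summand of the image of a module
of functions `E → Y` (`nonempty_retract_induced`). -/

namespace FDMod

open Limits

/-! ### Submodules, quotients, sums and factorizations of module maps. -/

section Constructions

variable {k : Type u} [Field k] {H : Type v} [Ring H] [Algebra k H]

/-- A submodule, as an object. -/
def ofSubmodule (M : FDMod k H) (W : Submodule k M.V) (hW : ∀ x, ∀ m ∈ W, M.act x m ∈ W) :
    FDMod k H where
  V := W
  act :=
    { toFun := fun x => (M.act x).restrict (hW x)
      map_one' := by ext; simp
      map_mul' := fun x y => by ext; simp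
      map_zero' := by ext; simp
      map_add' := fun x y => by ext; simp
      commutes' := fun c => by ext; simp [Module.algebraMap_end_apply] }

/-- The inclusion of a submodule. -/
def ofSubmoduleι (M : FDMod k H) (W : Submodule k M.V) (hW : ∀ x, ∀ m ∈ W, M.act x m ∈ W) :
    M.ofSubmodule W hW ⟶ M :=
  ⟨W.subtype, fun _ _ => rfl⟩

/-- A quotient module, as an object. -/
def ofQuotient (M : FDMod k H) (W : Submodule k M.V) (hW : ∀ x, ∀ m ∈ W, M.act x m ∈ W) :
    FDMod k H where
  V := M.V ⧸ W
  act :=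
    { toFun := fun x => W.mapQ W (M.act x) (hW x)
      map_one' := by ext; simp
      map_mul' := fun x y => by ext; simp
      map_zero' := by ext; simp
      map_add' := fun x y => by ext; simp
      commutes' := fun c => by ext; simp [Module.algebraMap_end_apply] }

/-- The projection to a quotient module. -/
def ofQuotientπ (M : FDMod k H) (W : Submodule k M.V) (hW : ∀ x, ∀ m ∈ W, M.act x m ∈ W) :
    M ⟶ M.ofQuotient W hW :=
  ⟨W.mkQ, fun _ _ => rfl⟩

/-- The direct sum of two modules. -/
def prod (M N : FDMod k H) : FDMod k H where
  V := M.V × N.V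
  act :=
    { toFun := fun x => (M.act x).prodMap (N.act x)
      map_one' := by ext <;> simp
      map_mul' := fun x y => by ext <;> simp
      map_zero' := by ext <;> simp
      map_add' := fun x y => by ext <;> simp
      commutes' := fun c => by ext <;> simp [Module.algebraMap_end_apply] }

/-- A finite-dimensional module in an arbitrary universe, transported to an object. -/
noncomputable def ofAct (W : Type w) [AddCommGroup W] [Module k W] [Module.Finite k W]
    (a : H →ₐ[k] Module.End k W) : FDMod k H where
  -- The carrier of an object must lie in the universe of `k`; a coordinate space does, wherever `W`
  -- lives. The double itself and spaces of functions on `E` are turned into objects this way.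
  V := Fin (Module.finrank k W) → k
  act := ((Module.finBasis k W).equivFun.conjAlgEquiv k).toAlgHom.comp a

/-- The identification of `ofAct W a` with `W`. -/
noncomputable def ofActEquiv (W : Type w) [AddCommGroup W] [Module k W] [Module.Finite k W]
    (a : H →ₐ[k] Module.End k W) : (ofAct W a).V ≃ₗ[k] W :=
  (Module.finBasis k W).equivFun.symm

theorem ofActEquiv_act (W : Type w) [AddCommGroup W] [Module k W] [Module.Finite k W]
    (a : H →ₐ[k] Module.End k W) (x : H) (m : (ofAct W a).V) :
    ofActEquiv W a ((ofAct W a).act x m) = a x (ofActEquiv W a m) :=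
  (Module.finBasis k W).equivFun.symm_apply_apply _

/-- The linear map underlying a morphism, as a linear function of it. -/
def linₗ (M N : FDMod k H) : (M ⟶ N) →ₗ[k] (M.V →ₗ[k] N.V) where
  toFun f := Hom.lin f
  map_add' _ _ := rfl
  map_smul' _ _ := rfl

/-- A linear retraction `r` of `f` need not be equivariant, but on the range of `f` it is the
inverse of `f`, and `g` takes its values there. -/
theorem exists_lift_of_injective {M N P : FDMod k H} (f : M ⟶ N) (g : P ⟶ N)
    (hf : Function.Injective (Hom.lin f))
    (h : LinearMap.range (Hom.lin g) ≤ LinearMap.range (Hom.lin f)) : ∃ l : P ⟶ M, l ≫ f = g := by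
  obtain ⟨r, hr⟩ := (Hom.lin f).exists_leftInverse_of_injective (LinearMap.ker_eq_bot.2 hf)
  have key : ∀ p, Hom.lin f (r (Hom.lin g p)) = Hom.lin g p := fun p => by
    obtain ⟨m, hm⟩ := h ⟨p, rfl⟩
    rw [← hm, show r (Hom.lin f m) = m from LinearMap.congr_fun hr m]
  exact ⟨⟨r ∘ₗ Hom.lin g, fun x p => hf (by
    simp only [LinearMap.comp_apply]
    rw [Hom.comm f, key, key, Hom.comm g])⟩, hom_ext (LinearMap.ext key)⟩

theorem exists_desc_of_surjective {M N P : FDMod k H} (f : M ⟶ N) (g : M ⟶ P)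
    (hf : Function.Surjective (Hom.lin f))
    (h : LinearMap.ker (Hom.lin f) ≤ LinearMap.ker (Hom.lin g)) : ∃ l : N ⟶ P, f ≫ l = g := by
  obtain ⟨s, hs⟩ := (Hom.lin f).exists_rightInverse_of_surjective (LinearMap.range_eq_top.2 hf)
  have key : ∀ m, Hom.lin g (s (Hom.lin f m)) = Hom.lin g m := fun m => by
    rw [← sub_eq_zero, ← map_sub]
    refine h ?_
    rw [LinearMap.mem_ker, map_sub, show Hom.lin f (s (Hom.lin f m)) = Hom.lin f m from
      LinearMap.congr_fun hs _, sub_self]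
  refine ⟨⟨Hom.lin g ∘ₗ s, fun x n => ?_⟩, hom_ext (LinearMap.ext key)⟩
  obtain ⟨m, rfl⟩ := hf n
  rw [← Hom.comm f]
  simp only [LinearMap.comp_apply, key, Hom.comm g]

end Constructions

/-! ### Abelian structure inherited along an embedding into modules. -/

section Embedding

variable {k : Type u} [Field k] {H : Type v} [Ring H] [Algebra k H]
  {C : Type*} [Category C] [Preadditive C] [Linear k C]

/-- A fully faithful linear functor to modules, whose image is closed under submodules,
quotients and direct sums. -/
structure IsExactEmbedding (Φ : C ⥤ FDMod k H) : Prop where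
  [full : Φ.Full]
  [faithful : Φ.Faithful]
  [additive : Φ.Additive]
  [linear : Φ.Linear k]
  sub : ∀ (X : C) (N : FDMod k H) (i : N ⟶ Φ.obj X), Function.Injective (Hom.lin i) →
    Φ.essImage N
  quot : ∀ (X : C) (N : FDMod k H) (p : Φ.obj X ⟶ N), Function.Surjective (Hom.lin p) →
    Φ.essImage N
  sum : ∀ X Y : C, Φ.essImage (prod (Φ.obj X) (Φ.obj Y))

namespace IsExactEmbedding

variable {Φ : C ⥤ FDMod k H} (h : IsExactEmbedding Φ)
include h

theorem exists_lift {X Y Z : C} (f : X ⟶ Y) (g : Z ⟶ Y)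
    (hf : Function.Injective (Hom.lin (Φ.map f)))
    (hg : LinearMap.range (Hom.lin (Φ.map g)) ≤ LinearMap.range (Hom.lin (Φ.map f))) :
    ∃ l : Z ⟶ X, l ≫ f = g := by
  have := h.full; have := h.faithful
  obtain ⟨l, hl⟩ := exists_lift_of_injective _ _ hf hg
  exact ⟨Φ.preimage l, Φ.map_injective (by simp [hl])⟩

theorem exists_desc {X Y Z : C} (f : X ⟶ Y) (g : X ⟶ Z)
    (hf : Function.Surjective (Hom.lin (Φ.map f)))
    (hg : LinearMap.ker (Hom.lin (Φ.map f)) ≤ LinearMap.ker (Hom.lin (Φ.map g))) :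
    ∃ l : Y ⟶ Z, f ≫ l = g := by
  have := h.full; have := h.faithful
  obtain ⟨l, hl⟩ := exists_desc_of_surjective _ _ hf hg
  exact ⟨Φ.preimage l, Φ.map_injective (by simp [hl])⟩

theorem exists_sub (X : C) (W : Submodule k (Φ.obj X).V)
    (hW : ∀ x, ∀ m ∈ W, (Φ.obj X).act x m ∈ W) :
    ∃ (K : C) (i : K ⟶ X), Function.Injective (Hom.lin (Φ.map i)) ∧
      LinearMap.range (Hom.lin (Φ.map i)) = W := by
  have := h.full
  obtain ⟨K, ⟨e⟩⟩ := h.sub X _ (ofSubmoduleι (Φ.obj X) W hW) W.injective_subtype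
  have he : Function.Bijective (Hom.lin e.hom) :=
    Function.bijective_iff_has_inverse.2 ⟨Hom.lin e.inv,
      LinearMap.congr_fun (congrArg Hom.lin e.hom_inv_id),
      LinearMap.congr_fun (congrArg Hom.lin e.inv_hom_id)⟩
  refine ⟨K, Φ.preimage (e.hom ≫ ofSubmoduleι (Φ.obj X) W hW), ?_, ?_⟩
  · rw [Φ.map_preimage]
    exact W.injective_subtype.comp he.1
  · rw [Φ.map_preimage, comp_lin, LinearMap.range_comp, LinearMap.range_eq_top.2 he.2,
      Submodule.map_top]
    exact W.range_subtype

theorem exists_quot (X : C) (W : Submodule k (Φ.obj X).V)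
    (hW : ∀ x, ∀ m ∈ W, (Φ.obj X).act x m ∈ W) :
    ∃ (Q : C) (p : X ⟶ Q), Function.Surjective (Hom.lin (Φ.map p)) ∧
      LinearMap.ker (Hom.lin (Φ.map p)) = W := by
  have := h.full
  obtain ⟨Q, ⟨e⟩⟩ := h.quot X _ (ofQuotientπ (Φ.obj X) W hW) W.mkQ_surjective
  have he : Function.Bijective (Hom.lin e.inv) :=
    Function.bijective_iff_has_inverse.2 ⟨Hom.lin e.hom,
      LinearMap.congr_fun (congrArg Hom.lin e.inv_hom_id),
      LinearMap.congr_fun (congrArg Hom.lin e.hom_inv_id)⟩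
  refine ⟨Q, Φ.preimage (ofQuotientπ (Φ.obj X) W hW ≫ e.inv), ?_, ?_⟩
  · rw [Φ.map_preimage]
    exact he.2.comp W.mkQ_surjective
  · rw [Φ.map_preimage, comp_lin, LinearMap.ker_comp, LinearMap.ker_eq_bot.2 he.1]
    exact W.ker_mkQ

theorem exists_ker {X Y : C} (f : X ⟶ Y) :
    ∃ (K : C) (i : K ⟶ X), Function.Injective (Hom.lin (Φ.map i)) ∧
      LinearMap.range (Hom.lin (Φ.map i)) = LinearMap.ker (Hom.lin (Φ.map f)) :=
  h.exists_sub X _ fun x m hm => by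
    rw [LinearMap.mem_ker] at hm ⊢
    rw [Hom.comm, hm, map_zero]

theorem exists_coker {X Y : C} (f : X ⟶ Y) :
    ∃ (Q : C) (p : Y ⟶ Q), Function.Surjective (Hom.lin (Φ.map p)) ∧
      LinearMap.ker (Hom.lin (Φ.map p)) = LinearMap.range (Hom.lin (Φ.map f)) :=
  h.exists_quot Y _ <| by
    rintro x _ ⟨m, rfl⟩
    exact ⟨_, Hom.comm (Φ.map f) x m⟩

theorem comp_eq_zero_iff {X Y Z : C} (f : X ⟶ Y) (g : Y ⟶ Z) : f ≫ g = 0 ↔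
    LinearMap.range (Hom.lin (Φ.map f)) ≤ LinearMap.ker (Hom.lin (Φ.map g)) := by
  have := h.faithful; have := h.additive
  rw [LinearMap.range_le_ker_iff, ← comp_lin, ← Φ.map_comp]
  constructor
  · intro e; rw [e, Φ.map_zero]; rfl
  · intro e; exact Φ.map_injective (by rw [Φ.map_zero]; exact hom_ext e)

theorem mono_iff {X Y : C} (f : X ⟶ Y) : Mono f ↔ Function.Injective (Hom.lin (Φ.map f)) := by
  have := h.faithful; have := h.additive
  constructor
  · intro hf
    obtain ⟨K, i, hi, hr⟩ := h.exists_ker f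
    have h0 : i = 0 := by
      rw [← cancel_mono f, zero_comp]
      exact (h.comp_eq_zero_iff i f).2 hr.le
    rw [← LinearMap.ker_eq_bot, ← hr, h0, Φ.map_zero]
    exact LinearMap.range_zero
  · refine fun hf => ⟨fun g g' e => Φ.map_injective (hom_ext (LinearMap.ext fun z => hf ?_))⟩
    have := congrArg (fun t => Hom.lin (Φ.map t) z) e
    simpa using this

theorem epi_iff {X Y : C} (f : X ⟶ Y) : Epi f ↔ Function.Surjective (Hom.lin (Φ.map f)) := by
  have := h.faithful; have := h.additive
  constructor
  · intro hf
    obtain ⟨K, i, hi, hr⟩ := h.exists_coker f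
    have h0 : i = 0 := by
      rw [← cancel_epi f, comp_zero]
      exact (h.comp_eq_zero_iff f i).2 hr.ge
    rw [← LinearMap.range_eq_top, ← hr, h0, Φ.map_zero]
    exact LinearMap.ker_zero
  · refine fun hf => ⟨fun g g' e => Φ.map_injective (hom_ext (LinearMap.ext fun z => ?_))⟩
    obtain ⟨y, rfl⟩ := hf z
    have := congrArg (fun t => Hom.lin (Φ.map t) y) e
    simpa using this

theorem isIso_iff {X Y : C} (f : X ⟶ Y) : IsIso f ↔ Function.Bijective (Hom.lin (Φ.map f)) := by
  have := h.full; have := h.faithful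
  constructor
  · intro hf
    exact ⟨(h.mono_iff f).1 inferInstance, (h.epi_iff f).1 inferInstance⟩
  · intro hf
    have : IsIso (Φ.map f) :=
      (isoMk (LinearEquiv.ofBijective _ hf) (Hom.comm (Φ.map f))).isIso_hom
    exact isIso_of_reflects_iso f Φ

/-- Exactness of the underlying vector spaces suffices for the universal property. This serves
twice: for the existence of kernels, and for exhibiting a monomorphism as the kernel of its
cokernel. -/
theorem isLimit_kernelFork {X Y Z : C} (f : X ⟶ Y) (g : Y ⟶ Z) (w : f ≫ g = 0)
    (hf : Function.Injective (Hom.lin (Φ.map f)))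
    (hg : LinearMap.ker (Hom.lin (Φ.map g)) ≤ LinearMap.range (Hom.lin (Φ.map f))) :
    Nonempty (IsLimit (KernelFork.ofι f w)) := by
  have := (h.mono_iff f).2 hf
  have hl {W : C} (t : W ⟶ Y) (ht : t ≫ g = 0) : ∃ l : W ⟶ X, l ≫ f = t :=
    h.exists_lift f t hf (((h.comp_eq_zero_iff t g).1 ht).trans hg)
  exact ⟨KernelFork.IsLimit.ofι' f w fun t ht => ⟨(hl t ht).choose, (hl t ht).choose_spec⟩⟩

theorem isColimit_cokernelCofork {X Y Z : C} (f : X ⟶ Y) (g : Y ⟶ Z) (w : f ≫ g = 0)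
    (hg : Function.Surjective (Hom.lin (Φ.map g)))
    (hf : LinearMap.ker (Hom.lin (Φ.map g)) ≤ LinearMap.range (Hom.lin (Φ.map f))) :
    Nonempty (IsColimit (CokernelCofork.ofπ g w)) := by
  have := (h.epi_iff g).2 hg
  have hl {W : C} (t : Y ⟶ W) (ht : f ≫ t = 0) : ∃ l : Z ⟶ W, g ≫ l = t :=
    h.exists_desc g t hg (hf.trans ((h.comp_eq_zero_iff f t).1 ht))
  exact ⟨CokernelCofork.IsColimit.ofπ' g w fun t ht => ⟨(hl t ht).choose, (hl t ht).choose_spec⟩⟩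

theorem hasKernels : HasKernels C where
  has_limit f := by
    obtain ⟨K, i, hi, hr⟩ := h.exists_ker f
    obtain ⟨l⟩ := h.isLimit_kernelFork i f ((h.comp_eq_zero_iff _ _).2 hr.le) hi hr.ge
    exact ⟨⟨_, l⟩⟩

theorem hasCokernels : HasCokernels C where
  has_colimit f := by
    obtain ⟨K, i, hi, hr⟩ := h.exists_coker f
    obtain ⟨l⟩ := h.isColimit_cokernelCofork f i ((h.comp_eq_zero_iff _ _).2 hr.ge) hi hr.le
    exact ⟨⟨_, l⟩⟩

theorem isNormalMonoCategory : IsNormalMonoCategory C where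
  normalMonoOfMono {X Y} f _ := by
    obtain ⟨Q, p, hp, hr⟩ := h.exists_coker f
    have w := (h.comp_eq_zero_iff f p).2 hr.ge
    obtain ⟨l⟩ := h.isLimit_kernelFork f p w ((h.mono_iff f).1 inferInstance) hr.le
    exact ⟨⟨Q, p, w, l⟩⟩

theorem isNormalEpiCategory : IsNormalEpiCategory C where
  normalEpiOfEpi {X Y} f _ := by
    obtain ⟨K, i, hi, hr⟩ := h.exists_ker f
    have w := (h.comp_eq_zero_iff i f).2 hr.le
    obtain ⟨l⟩ := h.isColimit_cokernelCofork i f w ((h.epi_iff f).1 inferInstance) hr.ge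
    exact ⟨⟨K, i, w, l⟩⟩

theorem isZero_iff (X : C) : IsZero X ↔ Subsingleton (Φ.obj X).V := by
  have := h.faithful; have := h.additive
  rw [IsZero.iff_id_eq_zero]
  constructor
  · intro e
    refine subsingleton_of_forall_eq 0 fun x => ?_
    have := congrArg (fun t => Hom.lin (Φ.map t) x) e
    simpa using this
  · intro e
    exact Φ.map_injective (hom_ext (LinearMap.ext fun x => Subsingleton.elim _ _))

theorem hasFiniteBiproducts [Nonempty C] : HasFiniteBiproducts C := by
  have := h.full; have := h.faithful; have := h.additive
  have hb : HasBinaryBiproducts C := ⟨fun X Y => by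
    obtain ⟨Z, ⟨e⟩⟩ := h.sum X Y
    let fst : prod (Φ.obj X) (Φ.obj Y) ⟶ Φ.obj X := ⟨LinearMap.fst k _ _, fun _ _ => rfl⟩
    let snd : prod (Φ.obj X) (Φ.obj Y) ⟶ Φ.obj Y := ⟨LinearMap.snd k _ _, fun _ _ => rfl⟩
    let inl : Φ.obj X ⟶ prod (Φ.obj X) (Φ.obj Y) := ⟨LinearMap.inl k _ _, fun x m =>
      Prod.ext rfl (map_zero ((Φ.obj Y).act x)).symm⟩
    let inr : Φ.obj Y ⟶ prod (Φ.obj X) (Φ.obj Y) := ⟨LinearMap.inr k _ _, fun x m =>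
      Prod.ext (map_zero ((Φ.obj X).act x)).symm rfl⟩
    have h1 : inl ≫ fst = 𝟙 _ := rfl
    have h2 : inl ≫ snd = 0 := rfl
    have h3 : inr ≫ fst = 0 := rfl
    have h4 : inr ≫ snd = 𝟙 _ := rfl
    have h5 : fst ≫ inl + snd ≫ inr = 𝟙 _ :=
      hom_ext (LinearMap.ext fun x => Prod.fst_add_snd x)
    refine HasBinaryBiproduct.mk ⟨_, isBinaryBilimitOfTotal
      { pt := Z
        fst := Φ.preimage (e.hom ≫ fst)
        snd := Φ.preimage (e.hom ≫ snd)
        inl := Φ.preimage (inl ≫ e.inv)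
        inr := Φ.preimage (inr ≫ e.inv)
        inl_fst := Φ.map_injective (by simp [h1])
        inl_snd := Φ.map_injective (by simp [h2])
        inr_fst := Φ.map_injective (by simp [h3])
        inr_snd := Φ.map_injective (by simp [h4]) } (Φ.map_injective ?_)⟩
    have : e.hom ≫ (fst ≫ inl + snd ≫ inr) ≫ e.inv = 𝟙 _ := by rw [h5]; simp
    simpa [Preadditive.add_comp, Preadditive.comp_add] using this⟩
  have hz : HasZeroObject C := by
    obtain ⟨X⟩ := ‹Nonempty C›
    -- The zero object is the zero submodule of any object, which is why `C` has to be nonempty.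
    obtain ⟨K, i, hi, hr⟩ := h.exists_sub X ⊥ (by simp)
    refine ⟨K, (h.isZero_iff K).2 (subsingleton_of_forall_eq 0 fun x => hi ?_)⟩
    have : Hom.lin (Φ.map i) x ∈ (⊥ : Submodule k (Φ.obj X).V) := hr ▸ ⟨x, rfl⟩
    rw [map_zero]
    exact (Submodule.mem_bot k).1 this
  have := hasFiniteProducts_of_has_binary_and_terminal (C := C)
  exact HasFiniteBiproducts.of_hasFiniteProducts

theorem finite_hom (X Y : C) : Module.Finite k (X ⟶ Y) := by
  have := h.faithful; have := h.linear; have := h.additive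
  exact Module.Finite.of_injective ((linₗ _ _).comp (Φ.mapLinearMap k (X := X) (Y := Y)))
    fun f g e => Φ.map_injective (hom_ext e)

theorem simple_of_finrank_eq_one (X : C) (hX : Module.finrank k (Φ.obj X).V = 1) : Simple X where
  mono_isIso_iff_nonzero {Y} f _ := by
    have := h.faithful; have := h.additive
    have hX0 : Nontrivial (Φ.obj X).V := Module.nontrivial_of_finrank_pos (R := k) (by omega)
    rw [h.isIso_iff]
    constructor
    · rintro hf rfl
      obtain ⟨x, hx⟩ := exists_ne (0 : (Φ.obj X).V)
      obtain ⟨y, rfl⟩ := hf.2 x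
      exact hx (by rw [Φ.map_zero]; rfl)
    · intro hf
      refine ⟨(h.mono_iff f).1 inferInstance, ?_⟩
      rw [← LinearMap.range_eq_top]
      refine ((isSimpleModule_iff_finrank_eq_one.2 hX).eq_bot_or_eq_top _).resolve_left
        fun h0 => hf (Φ.map_injective ?_)
      rw [Φ.map_zero]
      exact hom_ext (LinearMap.range_eq_bot.1 h0)

end IsExactEmbedding

end Embedding

end FDMod

namespace FDMod

open Limits

/-! ### Semisimplicity and finiteness of the set of simple objects. -/

section Embedding

variable {k : Type u} [Field k] {H : Type v} [Ring H] [Algebra k H]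
  {C : Type*} [Category C] [Preadditive C] [Linear k C]

/-- A finite family of simple objects of which `X` is the direct sum. -/
structure SimpleDecomposition (X : C) where
  ι : Type
  [fintype : Fintype ι]
  obj : ι → C
  inj : ∀ i, obj i ⟶ X
  pr : ∀ i, X ⟶ obj i
  simple : ∀ i, Simple (obj i)
  inj_pr_self : ∀ i, inj i ≫ pr i = 𝟙 (obj i)
  inj_pr_of_ne : ∀ i j, i ≠ j → inj i ≫ pr j = 0
  total : ∑ i, pr i ≫ inj i = 𝟙 X

attribute [instance] SimpleDecomposition.fintype SimpleDecomposition.simple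

/-- Every injective homomorphism of modules has a retraction. -/
def HasSplitting (k : Type u) [Field k] (H : Type v) [Ring H] [Algebra k H] : Prop :=
  ∀ {M N : FDMod k H} (i : M ⟶ N), Function.Injective (Hom.lin i) → ∃ p, i ≫ p = 𝟙 M

theorem SimpleDecomposition.exists_iso_biproduct [HasFiniteBiproducts C] {X : C}
    (d : SimpleDecomposition X) :
    ∃ (n : ℕ) (Y : Fin n → C), (∀ i, Simple (Y i)) ∧ Nonempty (X ≅ ⨁ Y) := by
  classical
  let e := Fintype.equivFin d.ι
  let Y : Fin (Fintype.card d.ι) → C := fun i => d.obj (e.symm i)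
  let b : Bicone Y :=
    { pt := X
      π := fun i => d.pr _
      ι := fun i => d.inj _
      ι_π := fun i j => by
        split_ifs with hij
        · subst hij
          exact d.inj_pr_self _
        · exact d.inj_pr_of_ne _ _ fun h => hij (e.symm.injective h) }
  have hb : b.IsBilimit := isBilimitOfTotal b <| by
    rw [← d.total]
    exact Equiv.sum_comp e.symm fun i => d.pr i ≫ d.inj i
  exact ⟨_, Y, fun i => d.simple _, ⟨biproduct.uniqueUpToIso Y hb⟩⟩

theorem isExactEmbedding_id : IsExactEmbedding (𝟭 (FDMod k H)) where
  sub _ N _ _ := ⟨N, ⟨Iso.refl _⟩⟩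
  quot _ N _ _ := ⟨N, ⟨Iso.refl _⟩⟩
  sum _ _ := ⟨_, ⟨Iso.refl _⟩⟩

namespace IsExactEmbedding

section

variable {Φ : C ⥤ FDMod k H} (h : IsExactEmbedding Φ)
include h

theorem finrank_lt {X Y : C} (f : X ⟶ Y) [Mono f] (hf : ¬ IsIso f) :
    Module.finrank k (Φ.obj X).V < Module.finrank k (Φ.obj Y).V := by
  have hi := (h.mono_iff f).1 inferInstance
  refine lt_of_le_of_ne (LinearMap.finrank_le_finrank_of_injective hi) fun e => hf ?_
  exact (h.isIso_iff f).2
    ⟨hi, (LinearMap.injective_iff_surjective_of_finrank_eq_finrank e).1 hi⟩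

theorem exists_retraction (hs : HasSplitting k H) {X Y : C} (f : X ⟶ Y) [Mono f] :
    ∃ p, f ≫ p = 𝟙 X := by
  have := h.full; have := h.faithful
  obtain ⟨p, hp⟩ := hs (Φ.map f) ((h.mono_iff f).1 inferInstance)
  exact ⟨Φ.preimage p, Φ.map_injective (by simp [hp])⟩

/-- Induction on the dimension: an object that is neither zero nor simple has a proper nonzero
subobject, which splits off, and both summands have smaller dimension. -/
theorem nonempty_simpleDecomposition (hs : HasSplitting k H) (X : C) :
    Nonempty (SimpleDecomposition X) := by
  have := h.hasKernels
  induction hn : Module.finrank k (Φ.obj X).V using Nat.strong_induction_on generalizing X with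
  | _ n ih =>
  by_cases h0 : 𝟙 X = 0
  · exact ⟨⟨Empty, Empty.elim, fun i => i.elim, fun i => i.elim, fun i => i.elim,
      fun i => i.elim, fun i => i.elim, by simp [h0]⟩⟩
  by_cases hX : Simple X
  · exact ⟨⟨Unit, fun _ => X, fun _ => 𝟙 X, fun _ => 𝟙 X, fun _ => hX, by simp,
      fun i j hij => (hij rfl).elim, by simp⟩⟩
  have : ∃ (Y : C) (f : Y ⟶ X) (_ : Mono f), f ≠ 0 ∧ ¬ IsIso f := by
    by_contra! hc
    refine hX ⟨fun {Y} f hf => ⟨?_, hc Y f hf⟩⟩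
    rintro hi rfl
    exact h0 (by rw [← IsIso.inv_hom_id (0 : Y ⟶ X), comp_zero])
  obtain ⟨Y, f, hf, hf0, hfi⟩ := this
  obtain ⟨p, hp⟩ := h.exists_retraction hs f
  let j := kernel.ι p
  -- The complement of `Y` is the kernel of the retraction, and `1 - p ≫ f` is the idempotent that
  -- projects onto it.
  let q : X ⟶ kernel p := kernel.lift p (𝟙 X - p ≫ f) (by simp [hp])
  have hqj : q ≫ j = 𝟙 X - p ≫ f := kernel.lift_ι _ _ _
  have hjp : j ≫ p = 0 := kernel.condition p
  have hfq : f ≫ q = 0 := by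
    rw [← cancel_mono j, Category.assoc, hqj]
    simp [reassoc_of% hp]
  have hjq : j ≫ q = 𝟙 _ := by
    rw [← cancel_mono j, Category.assoc, hqj]
    simp [reassoc_of% hjp]
  -- If the complement were everything then `p = 0`, and so `f = f ≫ p ≫ f = 0`.
  have hji : ¬ IsIso j := fun _ => hf0 <| by
    have : p = 0 := by rw [← cancel_epi j, hjp, comp_zero]
    rw [← Category.id_comp f, ← hp, this]
    simp
  obtain ⟨d⟩ := ih _ (hn ▸ h.finrank_lt f hfi) Y rfl
  obtain ⟨d'⟩ := ih _ (hn ▸ h.finrank_lt j hji) _ rfl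
  refine ⟨⟨d.ι ⊕ d'.ι, Sum.elim d.obj d'.obj,
    Sum.rec (fun i => d.inj i ≫ f) (fun i => d'.inj i ≫ j),
    Sum.rec (fun i => p ≫ d.pr i) (fun i => q ≫ d'.pr i), ?_, ?_, ?_, ?_⟩⟩
  · rintro (i | i)
    exacts [d.simple i, d'.simple i]
  · rintro (i | i)
    · simp [reassoc_of% hp, d.inj_pr_self]
    · simp [reassoc_of% hjq, d'.inj_pr_self]
  · rintro (i | i) (i' | i') hi
    · simp [reassoc_of% hp, d.inj_pr_of_ne i i' (by rintro rfl; exact hi rfl)]; rfl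
    · simp [reassoc_of% hfq]; rfl
    · simp [reassoc_of% hjp]; rfl
    · simp [reassoc_of% hjq, d'.inj_pr_of_ne i i' (by rintro rfl; exact hi rfl)]; rfl
  · rw [Fintype.sum_sum_type]
    have h1 : ∑ i, (p ≫ d.pr i) ≫ d.inj i ≫ f = p ≫ (∑ i, d.pr i ≫ d.inj i) ≫ f := by
      simp [Preadditive.sum_comp, Preadditive.comp_sum]
    have h2 : ∑ i, (q ≫ d'.pr i) ≫ d'.inj i ≫ j = q ≫ (∑ i, d'.pr i ≫ d'.inj i) ≫ j := by
      simp [Preadditive.sum_comp, Preadditive.comp_sum]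
    refine (congrArg₂ (· + ·) h1 h2).trans ?_
    rw [d.total, d'.total, Category.id_comp, Category.id_comp, hqj]
    abel

/-- Closure of the image under submodules is what makes this work: every subobject of `Φ.obj X`
already comes from `C`. It bounds the simple objects of `C` by those of the whole module category.
-/
theorem simple_obj (X : C) [Simple X] : Simple (Φ.obj X) where
  mono_isIso_iff_nonzero {N} f hf := by
    have := h.full; have := h.faithful; have := h.additive
    have hi : Function.Injective (Hom.lin f) := (isExactEmbedding_id.mono_iff f).1 hf
    obtain ⟨Y, ⟨e⟩⟩ := h.sub X N f hi
    have hm : Mono (Φ.preimage (e.hom ≫ f)) := by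
      rw [h.mono_iff, Φ.map_preimage]
      exact (isExactEmbedding_id.mono_iff (e.hom ≫ f)).1 inferInstance
    have h1 := Simple.mono_isIso_iff_nonzero (Φ.preimage (e.hom ≫ f))
    have h2 : Φ.preimage (e.hom ≫ f) = 0 ↔ f = 0 := by
      rw [← Φ.map_injective.eq_iff, Φ.map_preimage, Φ.map_zero, ← cancel_epi e.hom, comp_zero]
    rwa [ne_eq, h2, ← isIso_iff_of_reflects_iso _ Φ, Φ.map_preimage,
      isIso_comp_left_iff] at h1

end

end IsExactEmbedding

/-- The regular module. -/
noncomputable abbrev regular (k : Type u) [Field k] (H : Type v) [Ring H] [Algebra k H]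
    [Module.Finite k H] : FDMod k H :=
  ofAct H (Algebra.lmul k H)

/-- The homomorphism from the regular module that sends the unit to a given element. -/
noncomputable def ofRegular [Module.Finite k H] (M : FDMod k H) (m : M.V) : regular k H ⟶ M where
  lin := (LinearMap.applyₗ m ∘ₗ M.act.toLinearMap) ∘ₗ (ofActEquiv H (Algebra.lmul k H)).toLinearMap
  comm x y := by
    have := ofActEquiv_act H (Algebra.lmul k H) x y
    exact (congrArg (fun t => M.act t m) this).trans (by simp)

theorem ofRegular_one [Module.Finite k H] (M : FDMod k H) (m : M.V) :
    Hom.lin (ofRegular M m) ((ofActEquiv H (Algebra.lmul k H)).symm 1) = m := by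
  change M.act (ofActEquiv H (Algebra.lmul k H) ((ofActEquiv H (Algebra.lmul k H)).symm 1)) m = m
  simp

theorem eq_zero_of_regular_act_eq_zero [Module.Finite k H] {z : H}
    (h : (regular k H).act z = 0) : z = 0 := by
  have h1 := ofActEquiv_act H (Algebra.lmul k H) z ((ofActEquiv H (Algebra.lmul k H)).symm 1)
  rw [h, LinearMap.zero_apply, map_zero, LinearEquiv.apply_symm_apply] at h1
  exact (h1.trans (mul_one z)).symm

/-- A nonzero element of a simple module defines a nonzero map from the regular module. It is
nonzero on one of the finitely many simple summands, and there it is an isomorphism. -/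
theorem exists_finite_simple [Module.Finite k H] (hs : HasSplitting k H) :
    ∃ (n : ℕ) (Y : Fin n → FDMod k H), ∀ X : FDMod k H, Simple X → ∃ i, Nonempty (X ≅ Y i) := by
  have := (isExactEmbedding_id (k := k) (H := H)).hasKernels
  obtain ⟨d⟩ := isExactEmbedding_id.nonempty_simpleDecomposition hs (regular k H)
  refine ⟨_, d.obj ∘ (Fintype.equivFin d.ι).symm, fun X hX => ?_⟩
  obtain ⟨x, hx⟩ : ∃ x : X.V, x ≠ 0 := by
    by_contra! hc
    exact id_nonzero X (hom_ext (LinearMap.ext hc))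
  have hf : ofRegular X x ≠ 0 := fun h0 => hx (by rw [← ofRegular_one X x, h0]; rfl)
  obtain ⟨i, hi⟩ : ∃ i, d.inj i ≫ ofRegular X x ≠ 0 := by
    by_contra! hc
    apply hf
    rw [← Category.id_comp (ofRegular X x), ← d.total, Preadditive.sum_comp]
    simp [hc]
  have := isIso_of_hom_simple hi
  exact ⟨Fintype.equivFin d.ι i, by simpa using ⟨(asIso (d.inj i ≫ ofRegular X x)).symm⟩⟩

theorem IsExactEmbedding.exists_finite_simple {Φ : C ⥤ FDMod k H} (h : IsExactEmbedding Φ)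
    [Module.Finite k H] (hs : HasSplitting k H) :
    ∃ (n : ℕ) (Y : Fin n → C), ∀ X : C, Simple X → ∃ i, Nonempty (X ≅ Y i) := by
  classical
  obtain ⟨n, Y, hY⟩ := FDMod.exists_finite_simple hs
  have := h.full; have := h.faithful
  by_cases hC : Nonempty C
  · obtain ⟨X₀⟩ := hC
    -- Indices whose simple module does not come from `C` receive the arbitrary object `X₀`; the
    -- list may contain objects that are not simple.
    refine ⟨n, fun i => if hi : ∃ Z : C, Nonempty (Φ.obj Z ≅ Y i) then hi.choose else X₀,
      fun X hX => ?_⟩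
    obtain ⟨i, ⟨e⟩⟩ := hY _ (h.simple_obj X)
    have hi : ∃ Z : C, Nonempty (Φ.obj Z ≅ Y i) := ⟨X, ⟨e⟩⟩
    refine ⟨i, ?_⟩
    beta_reduce
    rw [dif_pos hi]
    exact ⟨Φ.preimageIso (e ≪≫ hi.choose_spec.some.symm)⟩
  · exact ⟨0, Fin.elim0, fun X => (hC ⟨X⟩).elim⟩

theorem exists_simple_representatives (hC : ∃ (n : ℕ) (Y : Fin n → C), ∀ X : C, Simple X →
    ∃ i, Nonempty (X ≅ Y i)) : ∃ (n : ℕ) (Y : Fin n → C), (∀ i, Simple (Y i)) ∧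
      (∀ i j, Nonempty (Y i ≅ Y j) → i = j) ∧ ∀ X : C, Simple X → ∃ i, Nonempty (X ≅ Y i) := by
  classical
  obtain ⟨n, Y, hY⟩ := hC
  -- Discard the objects that are not simple and keep the least index in each isomorphism class.
  let T := {i : Fin n // Simple (Y i) ∧ ∀ j < i, ¬ Nonempty (Y j ≅ Y i)}
  let e := Fintype.equivFin T
  refine ⟨_, fun i => Y (e.symm i).1, fun i => (e.symm i).2.1, fun i j hij => ?_, fun X hX => ?_⟩
  · refine e.symm.injective (Subtype.ext ?_)
    rcases lt_trichotomy (e.symm i).1 (e.symm j).1 with hlt | heq | hgt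
    · exact ((e.symm j).2.2 _ hlt hij).elim
    · exact heq
    · exact ((e.symm i).2.2 _ hgt ⟨hij.some.symm⟩).elim
  · have hne : (Finset.univ.filter fun i => Nonempty (X ≅ Y i)).Nonempty := by
      obtain ⟨i, hi⟩ := hY X hX
      exact ⟨i, by simpa using hi⟩
    obtain ⟨i, hi, hmin⟩ := Finset.exists_minimal hne
    obtain ⟨f⟩ := (Finset.mem_filter.1 hi).2
    have hT : Simple (Y i) ∧ ∀ j < i, ¬ Nonempty (Y j ≅ Y i) := by
      refine ⟨Simple.of_iso f.symm, fun j hj hji => ?_⟩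
      exact (hmin (Finset.mem_filter.2 ⟨Finset.mem_univ _, ⟨f ≪≫ hji.some.symm⟩⟩) hj.le).not_gt hj
    exact ⟨e ⟨i, hT⟩, by simpa using ⟨f⟩⟩

end Embedding

end FDMod

/-! ### Averaging over the double and Maschke's theorem. -/

section Double

open DrinfeldDouble FDMod

variable {k : Type u} [Field k] {G : Type v} [Group G] [Fintype G] [DecidableEq G]

instance : Module.Finite k (DrinfeldDouble k G) :=
  inferInstanceAs (Module.Finite k (G × G →₀ k))

namespace DGMod

/-- The condition of `e_mul_e` is solved for the index of the second factor, so that a sum over that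
index collapses to one term. -/
theorem e_mul_e_conj (a b g h : G) : e k a b * e k g h =
    if g = b⁻¹ * a * b then e k a (b * h) else 0 := by
  rw [e_mul_e]
  refine if_congr ⟨?_, ?_⟩ rfl rfl
  · rintro rfl; group
  · rintro rfl; group

/-- The average of a linear map between two modules over the double of a finite group. -/
noncomputable def average (M N : DGMod k G) (f : M.V →ₗ[k] N.V) : M ⟶ N where
  -- The elements `e_{h⁻¹gh} h⁻¹` form the basis dual to `e_g h` for the symmetric form given by the
  -- trace `e_g h ↦ δ_{h,1}`. The sum is the action of the corresponding Casimir element, hence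
  -- equivariant.
  lin := ∑ h : G, ∑ g : G, N.act (e k g h) ∘ₗ f ∘ₗ M.act (e k (h⁻¹ * g * h) h⁻¹)
  comm x m := by
    induction x using DrinfeldDouble.induction with
    | h0 => simp
    | hadd x y hx hy => simp only [map_add, LinearMap.add_apply, hx, hy]
    | hsmul c x hx => simp only [map_smul, LinearMap.smul_apply, hx]
    | he a b =>
      have l : ∀ h : G, ∑ g : G, N.act (e k g h) (f (M.act (e k (h⁻¹ * g * h) h⁻¹)
          (M.act (e k a b) m))) =
          N.act (e k a h) (f (M.act (e k (h⁻¹ * a * h) (h⁻¹ * b)) m)) := fun h => by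
        rw [Finset.sum_eq_single a]
        · rw [← Module.End.mul_apply, ← map_mul, e_mul_e_conj, if_pos (by group)]
        · intro g _ hg
          rw [← Module.End.mul_apply, ← map_mul, e_mul_e_conj, if_neg]
          · simp
          · rintro rfl; apply hg; group
        · simp
      have r : ∀ h : G, ∑ g : G, N.act (e k a b) (N.act (e k g h)
          (f (M.act (e k (h⁻¹ * g * h) h⁻¹) m))) =
          N.act (e k a (b * h)) (f (M.act (e k (h⁻¹ * b⁻¹ * a * b * h) h⁻¹) m)) := fun h => by
        rw [Finset.sum_eq_single (b⁻¹ * a * b)]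
        · rw [← Module.End.mul_apply, ← map_mul, e_mul_e_conj, if_pos rfl]
          simp only [mul_assoc]
        · intro g _ hg
          rw [← Module.End.mul_apply, ← map_mul, e_mul_e_conj, if_neg hg]
          simp
        · simp
      simp only [LinearMap.sum_apply, LinearMap.comp_apply, map_sum, l, r]
      -- After the collapse over `g`, the two sides differ by the substitution `h ↦ b h`.
      refine (Fintype.sum_equiv (Equiv.mulLeft b) _ _ fun h => ?_).symm
      simp [mul_assoc]

theorem average_apply (M N : DGMod k G) (f : M.V →ₗ[k] N.V) (m : M.V) :
    Hom.lin (average M N f) m =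
      ∑ h : G, ∑ g : G, N.act (e k g h) (f (M.act (e k (h⁻¹ * g * h) h⁻¹) m)) := by
  simp [average, LinearMap.sum_apply]

theorem sum_conj_mul (h : G) : ∑ g : G, e k (h⁻¹ * g * h) h⁻¹ * e k g h = 1 := by
  rw [one_eq]
  refine Fintype.sum_equiv (MulAut.conj h⁻¹).toEquiv _ _ fun g => ?_
  rw [e_mul_e_conj, if_pos (by group)]
  simp

theorem sum_mul_conj (h : G) : ∑ g : G, e k g h * e k (h⁻¹ * g * h) h⁻¹ = 1 := by
  rw [one_eq]
  refine Finset.sum_congr rfl fun g _ => ?_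
  rw [e_mul_e_conj, if_pos rfl, mul_inv_cancel]

/-- A linear retraction is averaged. For each `h` the Casimir terms multiply to `1`
(`sum_mul_conj`), so the average restricts to `|G|` times the identity, and `|G|` is invertible. -/
theorem hasSplitting [CharZero k] : HasSplitting k (DrinfeldDouble k G) := fun {M N} i hi => by
  obtain ⟨r, hr⟩ := (Hom.lin i).exists_leftInverse_of_injective (LinearMap.ker_eq_bot.2 hi)
  have hr' : ∀ m, r (Hom.lin i m) = m := LinearMap.congr_fun hr
  have hG : (Fintype.card G : k) ≠ 0 := Nat.cast_ne_zero.2 Fintype.card_ne_zero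
  refine ⟨(Fintype.card G : k)⁻¹ • average N M r, hom_ext (LinearMap.ext fun m => ?_)⟩
  have key : Hom.lin (average N M r) (Hom.lin i m) = (Fintype.card G : k) • m := by
    simp only [average_apply, ← Hom.comm i, hr']
    simp only [← Module.End.mul_apply, ← map_mul, ← LinearMap.sum_apply, ← map_sum, sum_mul_conj]
    simp [Nat.cast_smul_eq_nsmul]
  simp [key, smul_smul, hG]

end DGMod

end Double

/-! ### Duals, pivotal structure and quantum traces. -/

section Double

open DrinfeldDouble FDMod

variable {k : Type u} [Field k] {G : Type v} [Group G] [Fintype G] [DecidableEq G]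

namespace DrinfeldDouble

theorem antipode_mul (x y : DrinfeldDouble k G) :
    HopfAlgebraStruct.antipode k (x * y) =
      HopfAlgebraStruct.antipode k y * HopfAlgebraStruct.antipode k x := by
  induction x using induction with
  | h0 => simp
  | hadd x x' hx hx' => simp only [add_mul, mul_add, map_add, hx, hx']
  | hsmul c x hx => simp only [smul_mul_assoc, mul_smul_comm, map_smul, hx]
  | he g h =>
  induction y using induction with
  | h0 => simp
  | hadd x x' hx hx' => simp only [add_mul, mul_add, map_add, hx, hx']
  | hsmul c x hx => simp only [smul_mul_assoc, mul_smul_comm, map_smul, hx]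
  | he g' h' =>
    rw [e_mul_e, antipode_e, antipode_e, e_mul_e]
    by_cases h1 : g = h * g' * h⁻¹
    · rw [if_pos h1, if_pos (by rw [h1]; group), antipode_e, h1]
      congr 1 <;> group
    · rw [if_neg h1, if_neg, map_zero]
      intro h2
      apply h1
      have := congrArg (fun t => h * (h' * t * h'⁻¹)⁻¹ * h⁻¹) h2
      simpa [mul_assoc] using this.symm

theorem antipode_e_one (g : G) :
    HopfAlgebraStruct.antipode k (e k g 1) = e k g⁻¹ 1 := by
  rw [antipode_e]; simp

end DrinfeldDouble

namespace DGMod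

/-- The dual module, on which the double acts through its antipode. -/
noncomputable abbrev dual (M : DGMod k G) : DGMod k G where
  V := Module.Dual k M.V
  act := AlgHom.ofLinearMap
    (Module.Dual.transpose (R := k) ∘ₗ M.act.toLinearMap ∘ₗ
      HopfAlgebraStruct.antipode k (A := DrinfeldDouble k G))
    (by ext; simp [Module.Dual.transpose_apply])
    (fun x y => by ext; simp [antipode_mul, Module.Dual.transpose_apply])

theorem dual_act (M : DGMod k G) (x : DrinfeldDouble k G) (φ : Module.Dual k M.V) (m : M.V) :
    ((dual M).act x φ : Module.Dual k M.V) m = φ (M.act (HopfAlgebraStruct.antipode k x) m) := rfl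

/-- Under `M ⊗ M* ≅ End M` the coevaluation becomes the identity and `x ⊗ y` acts by `T ↦ x T S(y)`.
Equivariance of the coevaluation thus reduces to the antipode axiom. The flip is there because
`dualTensorHom` has the dual as left factor. -/
theorem dualTensorHom_comm_act₂ (M : DGMod k G) (x y : DrinfeldDouble k G)
    (z : M.V ⊗[k] Module.Dual k M.V) (m : M.V) :
    dualTensorHom k M.V M.V (TensorProduct.comm k _ _ (act₂ M (dual M) (x ⊗ₜ y) z)) m =
      M.act x (dualTensorHom k M.V M.V (TensorProduct.comm k _ _ z)
        (M.act (HopfAlgebraStruct.antipode k y) m)) := by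
  induction z with
  | zero => simp
  | add z z' hz hz' => simp only [map_add, LinearMap.add_apply, hz, hz']
  | tmul m' φ =>
    change φ (M.act (HopfAlgebraStruct.antipode k y) m) • M.act x m' = _
    simp

theorem dualTensorHom_comm_coevaluation (V : Type*) [AddCommGroup V] [Module k V]
    [Module.Finite k V] (c : k) (m : V) :
    dualTensorHom k V V (TensorProduct.comm k _ _ (coevaluation k V c)) m = c • m := by
  have h : coevaluation k V c = c • coevaluation k V 1 := by rw [← map_smul, smul_eq_mul, mul_one]
  rw [h, coevaluation_apply_one]
  simp only [map_smul, map_sum, LinearMap.smul_apply, LinearMap.sum_apply, TensorProduct.comm_tmul,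
    dualTensorHom_apply, Module.Basis.coord_apply, Module.Basis.sum_repr]

/-- The coevaluation of a module. -/
noncomputable def coev (M : DGMod k G) : 𝟙_ (DGMod k G) ⟶ M ⊗ dual M where
  lin := coevaluation k M.V
  comm x c := by
    have key : ∀ (t : DrinfeldDouble k G ⊗[k] DrinfeldDouble k G) (m : M.V),
        dualTensorHom k M.V M.V (TensorProduct.comm k _ _
          (act₂ M (dual M) t (coevaluation k M.V c))) m =
        c • M.act (LinearMap.mul' k _
          (LinearMap.lTensor _ (HopfAlgebraStruct.antipode k) t)) m := by
      intro t m
      induction t with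
      | zero => simp
      | add s t hs ht => simp only [map_add, LinearMap.add_apply, smul_add, hs, ht]
      | tmul x y =>
        rw [dualTensorHom_comm_act₂, dualTensorHom_comm_coevaluation]
        simp
    apply (TensorProduct.comm k _ _).injective
    apply (dualTensorHomEquiv k M.V M.V).injective
    refine LinearMap.ext fun m => ?_
    refine (dualTensorHom_comm_coevaluation M.V _ m).trans
      ((key (Coalgebra.comul (R := k) x) m).trans ?_).symm
    rw [HopfAlgebra.mul_antipode_lTensor_comul_apply]
    change _ = (Coalgebra.counit (R := k) x * c) • m
    simp [mul_smul, smul_comm c, Module.algebraMap_end_apply]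

/-- The evaluation of a module. -/
noncomputable def ev (M : DGMod k G) : dual M ⊗ M ⟶ 𝟙_ (DGMod k G) where
  lin := contractLeft k M.V
  comm x z := by
    have key : ∀ (t : DrinfeldDouble k G ⊗[k] DrinfeldDouble k G) (φ : Module.Dual k M.V) (m : M.V),
        contractLeft k M.V (act₂ (dual M) M t (φ ⊗ₜ m)) =
        φ (M.act (LinearMap.mul' k _
          (LinearMap.rTensor _ (HopfAlgebraStruct.antipode k) t)) m) := by
      intro t φ m
      induction t with
      | zero => simp
      | add s t hs ht => simp only [map_add, LinearMap.add_apply, hs, ht]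
      | tmul x y =>
        change φ (M.act (HopfAlgebraStruct.antipode k x) (M.act y m)) = _
        simp
    revert z
    change ∀ z : Module.Dual k M.V ⊗[k] M.V, contractLeft k M.V (act₂ (dual M) M
      (Coalgebra.comul (R := k) x) z) = Coalgebra.counit (R := k) x * contractLeft k M.V z
    intro z
    induction z with
    | zero => simp
    | add z z' hz hz' => simp only [map_add, mul_add, hz, hz']
    | tmul φ m =>
      rw [key, HopfAlgebra.mul_antipode_rTensor_comul_apply]
      simp [Module.algebraMap_end_apply]

noncomputable instance (M : DGMod k G) : ExactPairing M (dual M) where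
  coevaluation' := coev M
  evaluation' := ev M
  coevaluation_evaluation' := hom_ext (contractLeft_assoc_coevaluation k M.V)
  evaluation_coevaluation' := hom_ext (contractLeft_assoc_coevaluation' k M.V)

noncomputable instance : RightRigidCategory (DGMod k G) where
  rightDual M := ⟨dual M⟩

theorem ev_dual_tmul (M : DGMod k G) (g : G) (φ : Module.Dual k M.V) (m : M.V) :
    ((dual M).act (e k g 1) φ : Module.Dual k M.V) m = φ (M.act (e k g⁻¹ 1) m) := by
  rw [dual_act, antipode_e_one]

theorem sum_e_inv_mul_grp : ∑ g : G, e k g⁻¹ 1 * grp k g = drinfeldElt k G := by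
  simp only [e_mul_grp, one_mul, drinfeldElt]
  exact Fintype.sum_equiv (Equiv.inv G) _ _ fun g => by simp

/-- Braiding `m` past `φ` and evaluating gives `∑_g (e_g φ)(g m) = φ(∑_g e_{g⁻¹} g m)`, and the sum
is the Drinfeld element applied to `m`. The remaining coevaluation only expands a functional in a
basis. -/
theorem drinfeld_apply (M : DGMod k G) (m : M.V) :
    Hom.lin (Twist.drinfeld M) m = Module.Dual.eval k M.V (M.act (drinfeldElt k G) m) := by
  have h1 : ∀ φ : Module.Dual k M.V, contractLeft k M.V (Hom.lin (braid M (dual M)).hom (m ⊗ₜ φ)) =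
      φ (M.act (drinfeldElt k G) m) := fun φ => by
    rw [braid_tmul, map_sum, ← sum_e_inv_mul_grp, map_sum, LinearMap.sum_apply, map_sum]
    refine Finset.sum_congr rfl fun g _ => ?_
    rw [contractLeft_apply, ev_dual_tmul, map_mul, Module.End.mul_apply]
  have key : ∀ z : Module.Dual k M.V ⊗[k] Module.Dual k (Module.Dual k M.V),
      TensorProduct.lid k _ (TensorProduct.map (contractLeft k M.V) LinearMap.id
        (TensorProduct.map (Hom.lin (braid M (dual M)).hom) LinearMap.id
          ((TensorProduct.assoc k M.V (Module.Dual k M.V) _).symm (m ⊗ₜ z)))) =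
      TensorProduct.lid k _ (TensorProduct.map (Module.Dual.eval k M.V
        (M.act (drinfeldElt k G) m)) LinearMap.id z) := by
    intro z
    induction z with
    | zero => simp
    | add z z' hz hz' => simp only [map_add, TensorProduct.tmul_add, hz, hz']
    | tmul φ Ψ =>
      rw [TensorProduct.assoc_symm_tmul, TensorProduct.map_tmul, TensorProduct.map_tmul, h1]
      simp
  change TensorProduct.lid k _ (TensorProduct.map (contractLeft k M.V) LinearMap.id
        (TensorProduct.map (Hom.lin (braid M (dual M)).hom) LinearMap.id
          ((TensorProduct.assoc k M.V (Module.Dual k M.V) _).symm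
            (TensorProduct.map LinearMap.id (coevaluation k (Module.Dual k M.V))
              ((TensorProduct.rid k M.V).symm m))))) = _
  rw [TensorProduct.rid_symm_apply, TensorProduct.map_tmul, LinearMap.id_apply, key,
    coevaluation_apply_one]
  refine LinearMap.ext fun φ => ?_
  simp only [map_sum, TensorProduct.map_tmul, TensorProduct.lid_tmul, LinearMap.sum_apply,
    LinearMap.id_apply, LinearMap.smul_apply, Module.Basis.coord_apply, Module.Dual.eval_apply]
  conv_rhs => rw [← (Module.Basis.ofVectorSpace k (Module.Dual k M.V)).sum_repr φ]
  simp [LinearMap.sum_apply, mul_comm]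

/-- The twist element and the Drinfeld element are inverse to each other. This turns quantum traces
into ordinary traces. -/
theorem pivot_apply (M : DGMod k G) (m : M.V) :
    Hom.lin ((twist k G).pivot M) m = Module.Dual.eval k M.V m := by
  refine (drinfeld_apply M (M.act (twistElt k G) m)).trans ?_
  rw [← Module.End.mul_apply, ← map_mul, drinfeldElt_mul_twistElt, map_one, Module.End.one_apply]

/-- The pivotal structure, as an isomorphism. -/
noncomputable def pivotIso (M : DGMod k G) : M ≅ Twist.du (Twist.du M) :=
  isoMk (N := Twist.du (Twist.du M)) (Module.evalEquiv k M.V) fun x m => by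
    have h := Hom.comm ((twist k G).pivot M) x m
    rw [pivot_apply, pivot_apply] at h
    exact h

theorem pivotIso_hom (M : DGMod k G) : (pivotIso M).hom = (twist k G).pivot M :=
  hom_ext (LinearMap.ext fun m => (pivot_apply M m).symm)

theorem unit_hom_eq (f : 𝟙_ (DGMod k G) ⟶ 𝟙_ (DGMod k G)) {c : k}
    (h : Hom.lin f (1 : k) = c) : f = c • 𝟙 _ := by
  refine hom_ext (LinearMap.ext_ring (h.trans ?_))
  change c = c • (1 : k)
  simp

theorem trace_eq_sum_repr {ι V : Type*} [Fintype ι] [AddCommGroup V] [Module k V]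
    (b : Module.Basis ι k V) (f : V →ₗ[k] V) :
    LinearMap.trace k V f = ∑ i, b.repr (f (b i)) i := by
  classical
  rw [LinearMap.trace_eq_matrix_trace k b]
  simp [Matrix.trace, LinearMap.toMatrix_apply]

theorem traceR_eq (M : DGMod k G) (f : M ⟶ M) :
    (twist k G).traceR f = LinearMap.trace k M.V (Hom.lin f) • 𝟙 _ := by
  refine unit_hom_eq _ ?_
  change contractLeft k (Module.Dual k M.V) (TensorProduct.map
    (Hom.lin ((twist k G).pivot M) ∘ₗ Hom.lin f) LinearMap.id (coevaluation k M.V 1)) = _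
  rw [coevaluation_apply_one, trace_eq_sum_repr (Module.Basis.ofVectorSpace k M.V), map_sum,
    map_sum]
  refine Finset.sum_congr rfl fun i _ => ?_
  rw [TensorProduct.map_tmul, LinearMap.comp_apply, pivot_apply]
  rfl

theorem traceL_eq (M : DGMod k G) (f : M ⟶ M) :
    Twist.traceL (pivotIso M).inv f = LinearMap.trace k M.V (Hom.lin f) • 𝟙 _ := by
  refine unit_hom_eq _ ?_
  change contractLeft k M.V (TensorProduct.map LinearMap.id
    (Hom.lin f ∘ₗ (Module.evalEquiv k M.V).symm.toLinearMap)
      (coevaluation k (Module.Dual k M.V) 1)) = _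
  -- The coevaluation now belongs to `M*`, so its basis is one of the dual space and the sum
  -- computes the trace of the transpose of `f`.
  rw [coevaluation_apply_one, ← LinearMap.trace_transpose',
    trace_eq_sum_repr (Module.Basis.ofVectorSpace k (Module.Dual k M.V)), map_sum,
    map_sum]
  refine Finset.sum_congr rfl fun i _ => ?_
  rw [TensorProduct.map_tmul, contractLeft_apply, LinearMap.comp_apply]
  generalize Module.Basis.ofVectorSpace k (Module.Dual k M.V) = b at i
  -- By reflexivity each coordinate form on the dual is evaluation at a vector.
  obtain ⟨m, hm⟩ := (Module.evalEquiv k M.V).surjective (b.coord i)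
  change b i (Hom.lin f ((Module.evalEquiv k M.V).symm (b.coord i))) = b.coord i _
  rw [← hm, LinearEquiv.symm_apply_apply]
  rfl

theorem isSpherical : (twist k G).IsSpherical := fun M =>
  ⟨pivotIso M, pivotIso_hom M, fun f => (traceR_eq M f).trans (traceL_eq M f).symm⟩

section FullSubcategory

variable (P : ObjectProperty (DGMod k G)) [P.IsMonoidal] (hP : ∀ M, P M → P (dual M))

/-- The duals in a full monoidal subcategory that is closed under duals. -/
@[reducible]
noncomputable def rightRigidFullSubcategory : RightRigidCategory P.FullSubcategory where
  rightDual M :=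
    { rightDual := ⟨dual M.obj, hP _ M.property⟩
      exact :=
        { coevaluation' := ObjectProperty.homMk (coev M.obj)
          evaluation' := ObjectProperty.homMk (ev M.obj)
          coevaluation_evaluation' := ObjectProperty.hom_ext P
            (ExactPairing.coevaluation_evaluation M.obj (dual M.obj))
          evaluation_coevaluation' := ObjectProperty.hom_ext P
            (ExactPairing.evaluation_coevaluation M.obj (dual M.obj)) } }

theorem isSpherical_restrict :
    letI := rightRigidFullSubcategory P hP
    ((twist k G).restrict P).IsSpherical := fun M =>
  ⟨P.isoMk (pivotIso M.obj), ObjectProperty.hom_ext P (pivotIso_hom M.obj), fun f =>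
    ObjectProperty.hom_ext P ((traceR_eq M.obj f.hom).trans (traceL_eq M.obj f.hom).symm)⟩

end FullSubcategory

end DGMod
end Double

/-! ### Characters, the Drinfeld map and invertibility of the `S`-matrix. -/

section Double

open DrinfeldDouble FDMod

variable {k : Type u} [Field k] {G : Type v} [Group G] [Fintype G] [DecidableEq G]

namespace DGMod

open Limits

/-- The character of a module. -/
noncomputable def char (M : DGMod k G) : DrinfeldDouble k G →ₗ[k] k :=
  LinearMap.trace k M.V ∘ₗ M.act.toLinearMap

theorem char_apply (M : DGMod k G) (x : DrinfeldDouble k G) :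
    char M x = LinearMap.trace k M.V (M.act x) := rfl

theorem char_mul_comm (M : DGMod k G) (x y : DrinfeldDouble k G) :
    char M (x * y) = char M (y * x) := by
  rw [char_apply, char_apply, map_mul M.act, map_mul M.act, LinearMap.trace_mul_comm]

theorem trace_act₂ (M N : DGMod k G) (x y : DrinfeldDouble k G) :
    LinearMap.trace k (M.V ⊗[k] N.V) (act₂ M N (x ⊗ₜ y)) = char M x * char N y :=
  LinearMap.trace_tensorProduct' (M.act x) (N.act y)

theorem comm_rMatrix_mul_rMatrix : TensorProduct.comm k _ _ (rMatrix k G) * rMatrix k G =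
    ∑ a : G, ∑ b : G, e k a b ⊗ₜ[k] e k (a * b * a⁻¹) a := by
  simp only [rMatrix, map_sum, TensorProduct.comm_tmul, Finset.sum_mul_sum,
    Algebra.TensorProduct.tmul_mul_tmul, e_mul_grp, grp_mul_e, one_mul, mul_one]

theorem doubleBraiding_lin (M N : DGMod k G) :
    Hom.lin ((β_ M N).hom ≫ (β_ N M).hom) =
      act₂ M N (TensorProduct.comm k _ _ (rMatrix k G) * rMatrix k G) := by
  refine LinearMap.ext fun z => ?_
  rw [map_mul, Module.End.mul_apply]
  change TensorProduct.comm k N.V M.V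
    (act₂ N M (rMatrix k G) (TensorProduct.comm k M.V N.V (act₂ M N (rMatrix k G) z))) = _
  rw [comm_act₂]
  congr 1
  exact (TensorProduct.comm k M.V N.V).symm_apply_apply _

theorem traceR_doubleBraiding (M N : DGMod k G) :
    (twist k G).traceR ((β_ M N).hom ≫ (β_ N M).hom) =
      (∑ a : G, ∑ b : G, char M (e k a b) * char N (e k (a * b * a⁻¹) a)) • 𝟙 _ := by
  rw [traceR_eq, doubleBraiding_lin, comm_rMatrix_mul_rMatrix]
  congr 1
  rw [map_sum, map_sum]
  refine Finset.sum_congr rfl fun a _ => ?_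
  rw [map_sum, map_sum]
  exact Finset.sum_congr rfl fun b _ => trace_act₂ M N _ _

section ClassFunction

variable (f : DrinfeldDouble k G →ₗ[k] k)

/-- The image of a linear form under the map given by `R₂₁ R`. -/
noncomputable def drinfeldMap : DrinfeldDouble k G :=
  ∑ a : G, ∑ b : G, f (e k (a * b * a⁻¹) a) • e k a b

variable {f} (hf : ∀ x y, f (x * y) = f (y * x))
include hf

/-- Here `e_a · (e_a b) = e_a b`, whereas the product in the other order vanishes if `a` and `b` do
not commute. Trace forms thus live on commuting pairs. -/
theorem apply_e_eq_zero {a b : G} (hab : a * b ≠ b * a) : f (e k a b) = 0 := by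
  have h1 : e k a 1 * e k a b = e k a b := by rw [e_mul_e_conj, if_pos (by simp), one_mul]
  have h2 : e k a b * e k a 1 = 0 := by
    rw [e_mul_e_conj, if_neg]
    intro h
    apply hab
    rw [mul_assoc, eq_inv_mul_iff_mul_eq] at h
    exact h.symm
  rw [← h1, hf, h2, map_zero]

theorem apply_e_conj (a b d : G) : f (e k (d * a * d⁻¹) (d * b * d⁻¹)) = f (e k a b) := by
  have h : e k (d * a * d⁻¹) (d * b * d⁻¹) = grp k d * (e k a b * grp k d⁻¹) := by
    rw [e_mul_grp, grp_mul_e]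
    simp [mul_assoc]
  rw [h, hf, mul_assoc, grp_mul_grp, inv_mul_cancel, grp_one, mul_one]

theorem apply_e_drinfeld_conj (a b d : G) :
    f (e k ((d * a * d⁻¹) * (d * b * d⁻¹) * (d * a * d⁻¹)⁻¹) (d * a * d⁻¹)) =
      f (e k (a * b * a⁻¹) a) := by
  rw [← apply_e_conj hf (a * b * a⁻¹) a d]
  congr 2
  group

/-- For a basis element `e_c d` each product keeps only the first index compatible with `c`. The two
results then agree by conjugation invariance of `f` and its vanishing off commuting pairs. -/
theorem drinfeldMap_mul (x : DrinfeldDouble k G) : drinfeldMap f * x = x * drinfeldMap f := by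
  induction x using DrinfeldDouble.induction with
  | h0 => simp
  | hadd x y hx hy => simp only [mul_add, add_mul, hx, hy]
  | hsmul c x hx => simp only [mul_smul_comm, smul_mul_assoc, hx]
  | he c d =>
    have l : drinfeldMap f * e k c d =
        ∑ b : G, f (e k (c * b * c⁻¹) c) • e k c (b * d) := by
      rw [drinfeldMap, Finset.sum_mul, Finset.sum_congr rfl fun a _ => Finset.sum_mul _ _ _,
        Finset.sum_comm]
      refine Finset.sum_congr rfl fun b _ => ?_
      rw [Finset.sum_eq_single (b * c * b⁻¹)]
      · rw [smul_mul_assoc, e_mul_e_conj, if_pos (by group)]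
        have h := apply_e_drinfeld_conj hf c b b
        rw [mul_inv_cancel_right] at h
        rw [h]
        -- The surviving basis vector has index `b c b⁻¹` instead of `c`. These agree if `b` and `c`
        -- commute; otherwise the coefficient is zero on both sides.
        by_cases hbc : b * c = c * b
        · rw [hbc, mul_inv_cancel_right]
        · have h0 : f (e k (c * b * c⁻¹) c) = 0 := by
            refine apply_e_eq_zero hf fun h' => hbc ?_
            rw [inv_mul_cancel_right, mul_right_inj, eq_mul_inv_iff_mul_eq] at h'
            exact h'
          rw [h0, zero_smul, zero_smul]
      · intro a _ ha
        rw [smul_mul_assoc, e_mul_e_conj, if_neg, smul_zero]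
        rintro rfl
        apply ha
        group
      · simp
    have r : e k c d * drinfeldMap f =
        ∑ b : G, f (e k ((d⁻¹ * c * d) * b * (d⁻¹ * c * d)⁻¹) (d⁻¹ * c * d)) • e k c (d * b) := by
      rw [drinfeldMap, Finset.mul_sum, Finset.sum_eq_single (d⁻¹ * c * d)]
      · rw [Finset.mul_sum]
        refine Finset.sum_congr rfl fun b _ => ?_
        rw [mul_smul_comm, e_mul_e_conj, if_pos rfl]
      · intro a _ ha
        rw [Finset.mul_sum]
        refine Finset.sum_eq_zero fun b _ => ?_
        rw [mul_smul_comm, e_mul_e_conj, if_neg ha, smul_zero]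
      · simp
    rw [l, r]
    refine Fintype.sum_equiv (MulAut.conj d⁻¹).toEquiv _ _ fun b => ?_
    have h := apply_e_drinfeld_conj hf c b d⁻¹
    rw [inv_inv] at h
    change _ = f (e k (d⁻¹ * c * d * (d⁻¹ * b * d⁻¹⁻¹) * (d⁻¹ * c * d)⁻¹) (d⁻¹ * c * d)) •
      e k c (d * (d⁻¹ * b * d⁻¹⁻¹))
    rw [inv_inv, h]
    congr 2
    group

/-- The coefficient at `e_a b` is `f(e_{aba⁻¹} a)`, which for commuting `a` and `b` is `f(e_b a)`.
So the coefficients contain every value of `f` that can be nonzero. -/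
theorem eq_zero_of_drinfeldMap_eq_zero (h0 : drinfeldMap f = 0) : f = 0 := by
  have h : ∀ a b : G, f (e k (a * b * a⁻¹) a) = 0 := fun a b => by
    have := congrArg (DrinfeldDouble.lift fun g h => if g = a ∧ h = b then (1 : k) else 0) h0
    simpa [drinfeldMap, ite_and] using this
  refine DrinfeldDouble.lin_ext fun a b => ?_
  rw [LinearMap.zero_apply]
  by_cases hab : a * b = b * a
  · have := h b a
    rwa [← hab, mul_inv_cancel_right] at this
  · exact apply_e_eq_zero hf hab

end ClassFunction

/-- A central element of the double, as an endomorphism of a module. -/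
noncomputable def centralEnd (M : DGMod k G) (z : DrinfeldDouble k G) (hz : ∀ x, z * x = x * z) :
    M ⟶ M where
  lin := M.act z
  comm x m := by rw [← Module.End.mul_apply, ← map_mul, hz, map_mul, Module.End.mul_apply]

theorem nontrivial_of_simple (M : DGMod k G) [Simple M] : Nontrivial M.V := by
  by_contra h
  rw [not_nontrivial_iff_subsingleton] at h
  exact id_nonzero M (hom_ext (LinearMap.ext fun m => Subsingleton.elim _ _))

theorem exists_smul_id [IsAlgClosed k] (M : DGMod k G) [Simple M] (f : M ⟶ M) :
    ∃ c : k, Hom.lin f = c • LinearMap.id := by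
  have := (isExactEmbedding_id (k := k) (H := DrinfeldDouble k G)).hasKernels
  have : FiniteDimensional k (M ⟶ M) := isExactEmbedding_id.finite_hom M M
  obtain ⟨c, hc⟩ := endomorphism_simple_eq_smul_id k f
  exact ⟨c, by rw [← hc]; rfl⟩

theorem finrank_ne_zero [CharZero k] (M : DGMod k G) [Simple M] :
    (Module.finrank k M.V : k) ≠ 0 := by
  have := nontrivial_of_simple M
  exact Nat.cast_ne_zero.2 Module.finrank_pos.ne'

theorem char_eq_of_iso {M N : DGMod k G} (s : M ≅ N) : char M = char N := by
  refine LinearMap.ext fun x => ?_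
  let t : M.V ≃ₗ[k] N.V := LinearEquiv.ofLinearMap (Hom.lin s.hom) (Hom.lin s.inv)
    (congrArg Hom.lin s.inv_hom_id) (congrArg Hom.lin s.hom_inv_id)
  rw [char_apply, char_apply, ← LinearMap.trace_conj' (M.act x) t]
  congr 1
  refine LinearMap.ext fun n => ?_
  change Hom.lin s.hom (M.act x (t.symm n)) = _
  rw [Hom.comm s.hom]
  exact congrArg _ (t.apply_symm_apply n)

/-- On a simple module `M` the central element acts by a scalar `c`, and its character is `c · dim
M` with `dim M ≠ 0` in `k`; so `c = 0`. By semisimplicity `z` kills every module, in particular the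
faithful regular one. -/
theorem eq_zero_of_char_simple_eq_zero [IsAlgClosed k] [CharZero k] {z : DrinfeldDouble k G}
    (hz : ∀ x, z * x = x * z) (h : ∀ M : DGMod k G, Simple M → char M z = 0) : z = 0 := by
  have h1 : ∀ M : DGMod k G, Simple M → M.act z = 0 := fun M hM => by
    obtain ⟨c, hc⟩ := exists_smul_id M (centralEnd M z hz)
    change M.act z = c • LinearMap.id at hc
    have h2 := h M hM
    rw [char_apply, hc, map_smul, LinearMap.trace_id, smul_eq_mul] at h2
    rw [hc, (mul_eq_zero.1 h2).resolve_right (finrank_ne_zero M), zero_smul]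
  have h2 : ∀ M : DGMod k G, M.act z = 0 := fun M => by
    obtain ⟨d⟩ := isExactEmbedding_id.nonempty_simpleDecomposition hasSplitting M
    have h3 : centralEnd M z hz = ∑ i, d.pr i ≫ d.inj i ≫ centralEnd M z hz := by
      rw [← Category.id_comp (centralEnd M z hz)]
      nth_rw 1 [← d.total]
      simp [Preadditive.sum_comp]
    have h4 : ∀ i, d.inj i ≫ centralEnd M z hz = 0 := fun i =>
      hom_ext (LinearMap.ext fun x => by
        have := Hom.comm (d.inj i) z x
        rw [h1 _ (d.simple i), LinearMap.zero_apply, map_zero] at this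
        exact this.symm)
    exact congrArg Hom.lin (h3.trans (Finset.sum_eq_zero fun i _ => by rw [h4, comp_zero]))
  exact eq_zero_of_regular_act_eq_zero (h2 _)

/-- The pairing of the characters of two modules. -/
noncomputable def charPairing (M : DGMod k G) : (DrinfeldDouble k G →ₗ[k] k) →ₗ[k] k :=
  ∑ h : G, ∑ g : G, char M (e k (h⁻¹ * g * h) h⁻¹) • LinearMap.applyₗ (e k g h)

theorem charPairing_apply (M : DGMod k G) (f : DrinfeldDouble k G →ₗ[k] k) : charPairing M f =
    ∑ h : G, ∑ g : G, f (e k g h) * char M (e k (h⁻¹ * g * h) h⁻¹) := by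
  simp [charPairing, LinearMap.sum_apply, mul_comm]

/-- Products of diagonal matrix entries of the two actions, summed over dual bases, are entries of
averages of rank-one maps. Orthogonality of characters then becomes a statement on morphisms between
simple modules. -/
theorem charPairing_char {ι κ : Type*} [Fintype ι] [Fintype κ] (M N : DGMod k G)
    (b : Module.Basis ι k M.V) (b' : Module.Basis κ k N.V) :
    charPairing M (char N) = ∑ i, ∑ j,
      b'.repr (Hom.lin (average M N ((b.coord j).smulRight (b' i))) (b j)) i := by
  simp only [charPairing_apply, char_apply, trace_eq_sum_repr b, trace_eq_sum_repr b',
    average_apply,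
    map_sum, Finset.sum_mul_sum, Finsupp.finsetSum_apply]
  rw [Finset.sum_congr rfl fun h _ => Finset.sum_comm, Finset.sum_comm]
  refine Finset.sum_congr rfl fun i _ => ?_
  rw [Finset.sum_congr rfl fun h _ => Finset.sum_comm, Finset.sum_comm]
  refine Finset.sum_congr rfl fun j _ => ?_
  refine Finset.sum_congr rfl fun h _ => Finset.sum_congr rfl fun g _ => ?_
  simp [mul_comm]

theorem charPairing_char_of_not_iso (M N : DGMod k G) [Simple M] [Simple N]
    (h : ¬ Nonempty (M ≅ N)) : charPairing M (char N) = 0 := by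
  have := (isExactEmbedding_id (k := k) (H := DrinfeldDouble k G)).hasKernels
  have h0 : ∀ f : M ⟶ N, f = 0 := fun f => by
    by_contra hf
    have := isIso_of_hom_simple hf
    exact h ⟨asIso f⟩
  rw [charPairing_char M N (Module.finBasis k M.V) (Module.finBasis k N.V)]
  simp [h0]

theorem trace_average (M : DGMod k G) (f : M.V →ₗ[k] M.V) :
    LinearMap.trace k M.V (Hom.lin (average M M f)) =
      Fintype.card G * LinearMap.trace k M.V f := by
  have h1 : ∀ h : G, ∑ g : G, LinearMap.trace k M.V (M.act (e k g h) ∘ₗ f ∘ₗ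
      M.act (e k (h⁻¹ * g * h) h⁻¹)) = LinearMap.trace k M.V f := fun h => by
    have h2 : ∀ g : G, LinearMap.trace k M.V (M.act (e k g h) ∘ₗ f ∘ₗ
        M.act (e k (h⁻¹ * g * h) h⁻¹)) =
        LinearMap.trace k M.V (f * M.act (e k (h⁻¹ * g * h) h⁻¹ * e k g h)) := fun g => by
      rw [map_mul M.act, ← mul_assoc]
      exact LinearMap.trace_mul_comm k (M.act (e k g h)) (f * M.act (e k (h⁻¹ * g * h) h⁻¹))
    rw [Finset.sum_congr rfl fun g _ => h2 g, ← map_sum, ← Finset.mul_sum, ← map_sum,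
      sum_conj_mul, map_one, mul_one]
  simp only [average, map_sum, h1]
  simp

theorem charPairing_char_self [IsAlgClosed k] [CharZero k] (M : DGMod k G) [Simple M] :
    charPairing M (char M) = Fintype.card G := by
  let b := Module.finBasis k M.V
  -- The average is a scalar by Schur's lemma, and its trace `|G| · tr f` determines the scalar.
  have h1 : ∀ f : M.V →ₗ[k] M.V, Hom.lin (average M M f) =
      ((Fintype.card G * LinearMap.trace k M.V f) / Module.finrank k M.V : k) • LinearMap.id := by
    intro f
    obtain ⟨c, hc⟩ := exists_smul_id M (average M M f)
    have h2 := trace_average M f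
    rw [hc, map_smul, LinearMap.trace_id, smul_eq_mul] at h2
    rw [hc, ← h2, mul_div_cancel_right₀ _ (finrank_ne_zero M)]
  rw [charPairing_char M M b b]
  simp only [h1, LinearMap.smul_apply, LinearMap.id_apply, map_smul, Finsupp.smul_apply,
    Module.Basis.repr_self, LinearMap.trace_smulRight, Module.Basis.coord_apply, smul_eq_mul]
  -- A rank-one map built from `b j` and `b i` has trace `δ_{ij}`, so each `i` contributes `|G| /
  -- dim M`.
  have h2 : ∀ i : Fin (Module.finrank k M.V), ∑ j,
      (Fintype.card G : k) * (Finsupp.single i (1 : k)) j /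
      (Module.finrank k M.V : k) * (Finsupp.single j (1 : k)) i =
      (Fintype.card G : k) / (Module.finrank k M.V : k) := fun i => by
    rw [Finset.sum_eq_single i]
    · simp
    · intro j _ hj
      rw [Finsupp.single_eq_of_ne hj]
      simp
    · simp
  simp only [h2]
  rw [Finset.sum_const, Finset.card_univ, Fintype.card_fin, nsmul_eq_mul,
    mul_div_cancel₀ _ (finrank_ne_zero M)]

theorem isUnit_det_of_simple_representatives [IsAlgClosed k] [CharZero k] {n : ℕ}
    (X : Fin n → DGMod k G) (hX : ∀ i, Simple (X i)) (hX' : ∀ i j, Nonempty (X i ≅ X j) → i = j)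
    (hX'' : ∀ Y : DGMod k G, Simple Y → ∃ i, Nonempty (Y ≅ X i)) :
    IsUnit (Matrix.of fun i j => ∑ a : G, ∑ b : G,
      char (X i) (e k a b) * char (X j) (e k (a * b * a⁻¹) a)).det := by
  rw [isUnit_iff_ne_zero]
  intro hdet
  obtain ⟨v, hv, hS⟩ := Matrix.exists_mulVec_eq_zero_iff.2 hdet
  let f : DrinfeldDouble k G →ₗ[k] k := ∑ j, v j • char (X j)
  have hf : ∀ x y, f (x * y) = f (y * x) := fun x y => by
    simp [f, LinearMap.sum_apply, char_mul_comm (X _) x y]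
  -- The value of `χ_i` on the Drinfeld image of `f` is the entry of index `i` of the `S`-matrix
  -- applied to `v`.
  have h1 : ∀ i, char (X i) (drinfeldMap f) = 0 := fun i => by
    refine Eq.trans ?_ (congrFun hS i)
    simp only [drinfeldMap, map_sum, map_smul, Matrix.mulVec, dotProduct, Matrix.of_apply,
      Finset.sum_mul, smul_eq_mul]
    refine Eq.trans ?_ Finset.sum_comm
    refine Finset.sum_congr rfl fun a _ => ?_
    refine Eq.trans ?_ Finset.sum_comm
    refine Finset.sum_congr rfl fun b _ => ?_
    simp only [f, LinearMap.sum_apply, LinearMap.smul_apply, smul_eq_mul, Finset.sum_mul]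
    exact Finset.sum_congr rfl fun j _ => by ring
  have h2 : f = 0 := by
    refine eq_zero_of_drinfeldMap_eq_zero hf (eq_zero_of_char_simple_eq_zero (drinfeldMap_mul hf)
      fun M hM => ?_)
    obtain ⟨i, ⟨s⟩⟩ := hX'' M hM
    rw [char_eq_of_iso s, h1]
  refine hv (funext fun i => ?_)
  -- Orthogonality recovers the coefficients of `f`.
  have h3 : charPairing (X i) f = v i * Fintype.card G := by
    simp only [f, map_sum, map_smul, smul_eq_mul]
    rw [Finset.sum_eq_single i]
    · rw [charPairing_char_self]
    · intro j _ hj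
      rw [charPairing_char_of_not_iso _ _ fun hij => hj (hX' i j hij).symm, mul_zero]
    · simp
  rw [h2] at h3
  have hG : (Fintype.card G : k) ≠ 0 := Nat.cast_ne_zero.2 Fintype.card_ne_zero
  have h4 : v i * Fintype.card G = 0 := h3.symm.trans (map_zero _)
  exact (mul_eq_zero.1 h4).resolve_right hG

/-! ### Fusion, modular and premodular structures. -/

theorem isFusion [CharZero k] : IsFusion k (DGMod k G) :=
  have h := isExactEmbedding_id (k := k) (H := DrinfeldDouble k G)
  have : Nonempty (DGMod k G) := ⟨𝟙_ _⟩
  { hasFiniteBiproducts := h.hasFiniteBiproducts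
    hasKernels := h.hasKernels
    hasCokernels := h.hasCokernels
    normalMono := h.isNormalMonoCategory
    normalEpi := h.isNormalEpiCategory
    monoidalLinear := inferInstance
    finite_hom := h.finite_hom
    semisimple := fun X =>
      have := h.hasFiniteBiproducts
      (h.nonempty_simpleDecomposition hasSplitting X).some.exists_iso_biproduct
    finite_simple := h.exists_finite_simple hasSplitting
    simple_unit := h.simple_of_finrank_eq_one _ (Module.finrank_self k)
    rigid := ⟨BraidedCategory.rigidCategoryOfRightRigidCategory⟩ }

theorem isModular [IsAlgClosed k] [CharZero k] : IsModular k (twist k G) where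
  fusion := isFusion
  spherical := ⟨inferInstance, isSpherical⟩
  nondegenerate := by
    obtain ⟨n, X, h1, h2, h3⟩ := exists_simple_representatives (C := DGMod k G)
      isFusion.finite_simple
    exact ⟨inferInstance, n, X, _, h1, h2, h3, fun i j => traceR_doubleBraiding (X i) (X j),
      isUnit_det_of_simple_representatives X h1 h2 h3⟩

section FullSubcategory

variable (P : ObjectProperty (DGMod k G)) [P.IsMonoidal]

theorem isPremodular_restrict [CharZero k] (hdual : ∀ M, P M → P (dual M))
    (hsub : ∀ (M N : DGMod k G) (i : N ⟶ M), Function.Injective (Hom.lin i) → P M → P N)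
    (hquot : ∀ (M N : DGMod k G) (p : M ⟶ N), Function.Surjective (Hom.lin p) → P M → P N)
    (hprod : ∀ M N : DGMod k G, P M → P N → P (FDMod.prod M N)) :
    IsPremodular k ((twist k G).restrict P) :=
  have h : IsExactEmbedding P.ι :=
    { sub := fun X N i hi => ⟨⟨N, hsub X.obj N i hi X.property⟩, ⟨Iso.refl _⟩⟩
      quot := fun X N p hp => ⟨⟨N, hquot X.obj N p hp X.property⟩, ⟨Iso.refl _⟩⟩
      sum := fun X Y => ⟨⟨_, hprod X.obj Y.obj X.property Y.property⟩, ⟨Iso.refl _⟩⟩ }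
  letI := rightRigidFullSubcategory P hdual
  have : Nonempty P.FullSubcategory := ⟨𝟙_ _⟩
  { fusion :=
      { hasFiniteBiproducts := h.hasFiniteBiproducts
        hasKernels := h.hasKernels
        hasCokernels := h.hasCokernels
        normalMono := h.isNormalMonoCategory
        normalEpi := h.isNormalEpiCategory
        monoidalLinear := inferInstance
        finite_hom := h.finite_hom
        semisimple := fun X =>
          have := h.hasFiniteBiproducts
          (h.nonempty_simpleDecomposition hasSplitting X).some.exists_iso_biproduct
        finite_simple := h.exists_finite_simple hasSplitting
        simple_unit := h.simple_of_finrank_eq_one _ (Module.finrank_self k)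
        rigid := ⟨BraidedCategory.rigidCategoryOfRightRigidCategory⟩ }
    spherical := ⟨inferInstance, isSpherical_restrict P hdual⟩ }

end FullSubcategory

end DGMod
end Double

/-! ### Graded representations and descent along a surjection of groups. -/

section Double

open DrinfeldDouble FDMod

variable {k : Type u} [Field k] {G : Type v} [Group G] [Fintype G] [DecidableEq G]

namespace DGMod

/-- A `G`-grading of a vector space, given by the projections, with a compatible action of `G`. -/
structure GradedRep (k : Type u) [Field k] (G : Type v) [Group G] [Fintype G] [DecidableEq G]
    (W : Type w) [AddCommGroup W] [Module k W] where
  proj : G → Module.End k W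
  rep : G →* Module.End k W
  proj_mul_proj : ∀ g h, proj g * proj h = if g = h then proj g else 0
  sum_proj : ∑ g, proj g = 1
  rep_mul_proj : ∀ g h, rep h * proj g = proj (h * g * h⁻¹) * rep h

namespace GradedRep

variable {W : Type w} [AddCommGroup W] [Module k W] (r : GradedRep k G W)

/-- The action of the double given by a grading and a compatible action of the group. -/
noncomputable def act : DrinfeldDouble k G →ₐ[k] Module.End k W :=
  AlgHom.ofLinearMap (DrinfeldDouble.lift fun g h => r.proj g * r.rep h)
    (by simp [one_eq, r.sum_proj])
    fun x y => by
      induction x using DrinfeldDouble.induction with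
      | h0 => simp
      | hadd x x' hx hx' => simp only [add_mul, map_add, hx, hx']
      | hsmul c x hx => simp only [smul_mul_assoc, map_smul, hx]
      | he g h =>
      induction y using DrinfeldDouble.induction with
      | h0 => simp
      | hadd x x' hx hx' => simp only [mul_add, map_add, hx, hx']
      | hsmul c x hx => simp only [mul_smul_comm, map_smul, hx]
      | he g' h' =>
        rw [e_mul_e, lift_e, lift_e, mul_assoc (r.proj g), ← mul_assoc (r.rep h), r.rep_mul_proj,
          ← mul_assoc (r.proj g), ← mul_assoc (r.proj g), r.proj_mul_proj]
        split_ifs with h1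
        · rw [lift_e, map_mul, mul_assoc]
        · simp

theorem act_e (g h : G) : r.act (e k g h) = r.proj g * r.rep h :=
  lift_e (fun g h => r.proj g * r.rep h) g h

theorem act_e_one (g : G) : r.act (e k g 1) = r.proj g := by
  rw [act_e, map_one, mul_one]

theorem act_grp (h : G) : r.act (grp k h) = r.rep h := by
  rw [grp, map_sum]
  simp only [act_e]
  rw [← Finset.sum_mul, r.sum_proj, one_mul]

end GradedRep

/-- Since `e_g h = e_g · h`, the double is generated by the grading projections and the group.
Equivariance of all maps below is checked on these two families. -/
theorem comm_of_generators {M N : DGMod k G} (f : M.V →ₗ[k] N.V)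
    (h1 : ∀ g m, f (M.act (e k g 1) m) = N.act (e k g 1) (f m))
    (h2 : ∀ g m, f (M.act (grp k g) m) = N.act (grp k g) (f m)) (x : DrinfeldDouble k G)
    (m : M.V) : f (M.act x m) = N.act x (f m) := by
  induction x using DrinfeldDouble.induction with
  | h0 => simp
  | hadd x y hx hy => simp only [map_add, LinearMap.add_apply, hx, hy]
  | hsmul c x hx => simp only [map_smul, LinearMap.smul_apply, hx]
  | he g h =>
    have : e k g h = e k g 1 * grp k h := by rw [e_mul_grp, one_mul]
    rw [this, map_mul, map_mul, Module.End.mul_apply, Module.End.mul_apply, h1, h2]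

variable {E : Type*} [Group E] [Fintype E] [DecidableEq E] (q : E →* G)

/-- The kernel of `q` acts trivially. -/
def KerTrivial (X : DGMod k E) : Prop := ∀ x, q x = 1 → X.act (grp k x) = 1

theorem act_grp_mul_act_e (X : DGMod k G) (g h : G) :
    X.act (grp k h) * X.act (e k g 1) = X.act (e k (h * g * h⁻¹) 1) * X.act (grp k h) := by
  rw [← map_mul, ← map_mul, grp_mul_e, e_mul_grp, mul_one, one_mul]

section Descend

variable {q}

omit [Fintype G] [DecidableEq G] in
theorem KerTrivial.act_grp_eq {X : DGMod k E} (hX : KerTrivial q X) {x y : E} (h : q x = q y) :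
    X.act (grp k x) = X.act (grp k y) := by
  rw [← mul_inv_cancel_left y x, ← grp_mul_grp, map_mul, hX (y⁻¹ * x) (by simp [h]), mul_one]

variable (hq : Function.Surjective q) (X : DGMod k E) (hX : KerTrivial q X)

/-- The `G`-grading and the action of `G` on a `D(E)`-module on which the kernel of `q : E → G`
acts trivially. -/
noncomputable def descendRep : GradedRep k G X.V where
  -- The degree `g` part collects the degrees in the fibre over `g`.
  proj g := ∑ x : E, if q x = g then X.act (e k x 1) else 0
  rep :=
    -- The chosen section need not be multiplicative, but by `KerTrivial.act_grp_eq` the action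
    -- depends only on the image in `G`.
    { toFun := fun h => X.act (grp k (Function.surjInv hq h))
      map_one' := hX _ (Function.surjInv_eq hq 1)
      map_mul' := fun g h => by
        rw [← map_mul, grp_mul_grp]
        exact hX.act_grp_eq (by simp [Function.surjInv_eq]) }
  proj_mul_proj g h := by
    rw [Finset.sum_mul_sum]
    have : ∀ x y : E, (if q x = g then X.act (e k x 1) else 0) *
        (if q y = h then X.act (e k y 1) else 0) =
        if x = y then (if g = h then (if q x = g then X.act (e k x 1) else 0) else 0) else 0 := by
      intro x y
      by_cases hxy : x = y
      · subst hxy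
        by_cases hgh : g = h
        · subst hgh
          by_cases hx : q x = g
          · simp [hx, ← map_mul, e_one_mul_e_one]
          · simp [hx]
        · by_cases hx : q x = g
          · simp [hgh, show q x ≠ h from fun h' => hgh (hx.symm.trans h')]
          · simp [hx]
      · rw [if_neg hxy, ite_mul, mul_ite, ← map_mul, e_one_mul_e_one, if_neg hxy]
        simp
    simp only [this]
    simp
  sum_proj := by
    rw [Finset.sum_comm]
    simp [← map_sum, ← one_eq]
  rep_mul_proj g h := by
    change X.act (grp k (Function.surjInv hq h)) * _ = _ * X.act (grp k (Function.surjInv hq h))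
    rw [Finset.mul_sum, Finset.sum_mul]
    refine Fintype.sum_equiv (MulAut.conj (Function.surjInv hq h)).toEquiv _ _ fun x => ?_
    have : q (MulAut.conj (Function.surjInv hq h) x) = h * g * h⁻¹ ↔ q x = g := by
      simp [Function.surjInv_eq]
    change _ = (if q (MulAut.conj (Function.surjInv hq h) x) = h * g * h⁻¹ then _ else _) * _
    simp only [this, mul_ite, ite_mul, mul_zero, zero_mul]
    rw [act_grp_mul_act_e]
    rfl

/-- A `D(E)`-module on which the kernel of `q : E → G` acts trivially, seen as a
`D(G)`-module. -/
noncomputable abbrev descend : DGMod k G where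
  V := X.V
  act := (descendRep hq X hX).act

theorem descend_act_e_one (g : G) (m : X.V) : (descend hq X hX).act (e k g 1) m =
    ∑ x : E, if q x = g then X.act (e k x 1) m else 0 := by
  refine (LinearMap.congr_fun (GradedRep.act_e_one _ g) m).trans ?_
  refine (LinearMap.sum_apply _ _ _).trans (Finset.sum_congr rfl fun x _ => ?_)
  split_ifs <;> rfl

theorem descend_act_grp (y : E) (m : X.V) :
    (descend hq X hX).act (grp k (q y)) m = X.act (grp k y) m := by
  refine (LinearMap.congr_fun (GradedRep.act_grp _ (q y)) m).trans ?_
  exact LinearMap.congr_fun (hX.act_grp_eq (Function.surjInv_eq hq _)) m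

/-- On the degree `x` part the twist over `E` acts by `x`, and the twist over `G` acts by `q x`,
which is the same operator. -/
theorem descend_act_twistElt (m : X.V) :
    (descend hq X hX).act (twistElt k G) m = X.act (twistElt k E) m := by
  have h1 : ∀ g : G, (descend hq X hX).act (e k g g) m =
      ∑ x : E, if q x = g then X.act (e k x x) m else 0 := fun g => by
    have : e k g g = e k g 1 * grp k g := by rw [e_mul_grp, one_mul]
    rw [this, map_mul, Module.End.mul_apply, descend_act_e_one]
    refine Finset.sum_congr rfl fun x _ => ?_
    split_ifs with h
    · rw [← h, descend_act_grp, ← Module.End.mul_apply, ← map_mul, e_mul_grp, one_mul]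
    · rfl
  rw [twistElt, twistElt, map_sum, map_sum, LinearMap.sum_apply, LinearMap.sum_apply,
    Finset.sum_congr rfl fun g _ => h1 g, Finset.sum_comm]
  simp

theorem descend_comm {X Y : DGMod k E} (hX : KerTrivial q X) (hY : KerTrivial q Y) (f : X ⟶ Y)
    (x : DrinfeldDouble k G) (m : X.V) :
    Hom.lin f ((descend hq X hX).act x m) = (descend hq Y hY).act x (Hom.lin f m) := by
  refine comm_of_generators (M := descend hq X hX) (N := descend hq Y hY)
    (Hom.lin (M := X) (N := Y) f)
    (fun g m => ?_) (fun g m => ?_) x m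
  · rw [descend_act_e_one, descend_act_e_one, map_sum]
    refine Finset.sum_congr rfl fun x _ => ?_
    rw [apply_ite (Hom.lin f), Hom.comm f, map_zero]
  · obtain ⟨y, rfl⟩ := hq g
    rw [descend_act_grp, descend_act_grp, Hom.comm f]

theorem descend_unit (h : KerTrivial q (𝟙_ (DGMod k E))) (x : DrinfeldDouble k G) (m : k) :
    ((𝟙_ (DGMod k G)).act x m : k) = (descend hq (𝟙_ (DGMod k E)) h).act x m := by
  refine comm_of_generators (M := 𝟙_ (DGMod k G)) (N := descend hq (𝟙_ (DGMod k E)) h)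
    (LinearMap.id : k →ₗ[k] k) (fun g m => ?_) (fun g m => ?_) x m
  · rw [descend_act_e_one]
    change Coalgebra.counit (R := k) (e k g 1) * m =
      ∑ x : E, if q x = g then Coalgebra.counit (R := k) (e k x 1) * m else 0
    simp only [counit_e]
    rw [Finset.sum_eq_single 1]
    · simp [eq_comm]
    · intro x _ hx
      simp [hx]
    · simp
  · obtain ⟨y, rfl⟩ := hq g
    refine Eq.trans ?_ (descend_act_grp hq _ h y m).symm
    change Coalgebra.counit (R := k) (grp k (q y)) * m = Coalgebra.counit (R := k) (grp k y) * m
    simp [grp, counit_e]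

theorem descend_tensor {X Y : DGMod k E} (hX : KerTrivial q X) (hY : KerTrivial q Y)
    (h : KerTrivial q (X ⊗ Y)) (x : DrinfeldDouble k G) (z : X.V ⊗[k] Y.V) :
    ((descend hq X hX ⊗ descend hq Y hY).act x z : X.V ⊗[k] Y.V) =
      (descend hq (X ⊗ Y) h).act x z := by
  refine comm_of_generators (M := descend hq X hX ⊗ descend hq Y hY)
    (N := descend hq (X ⊗ Y) h) (LinearMap.id : X.V ⊗[k] Y.V →ₗ[k] X.V ⊗[k] Y.V)
    (fun g => ?_) (fun g => ?_) x z
  · refine LinearMap.congr_fun (f := (descend hq X hX ⊗ descend hq Y hY).act (e k g 1))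
      (g := (descend hq (X ⊗ Y) h).act (e k g 1)) (TensorProduct.ext' fun m n => ?_)
    refine (act_e_tmul _ _ g 1 m n).trans
      ((descend_act_e_one hq (X ⊗ Y) h g (m ⊗ₜ[k] n)).trans ?_).symm
    have l : ∀ x : E, (if q x = g then (X ⊗ Y).act (e k x 1) (m ⊗ₜ[k] n) else 0 :
        X.V ⊗[k] Y.V) = ∑ b : E, if q x = g then
          X.act (e k (b⁻¹ * x) 1) m ⊗ₜ[k] Y.act (e k b 1) n else 0 := fun x => by
      split_ifs
      · exact act_e_tmul X Y x 1 m n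
      · simp
    -- Over `G` the terms are indexed by pairs with `q b = a` and `q u = a⁻¹ g`. Summed over `a`,
    -- these are the pairs with `q (b u) = g`, which match those of the coproduct over `E` through
    -- `x = b u`.
    have r : ∀ a : G, ((descend hq X hX).act (e k (a⁻¹ * g) 1) m ⊗ₜ
        (descend hq Y hY).act (e k a 1) n : X.V ⊗[k] Y.V) =
        ∑ b : E, if q b = a then ∑ u : E, if q (b * u) = g then
          X.act (e k u 1) m ⊗ₜ[k] Y.act (e k b 1) n else 0 else 0 := fun a => by
      rw [descend_act_e_one, descend_act_e_one]
      refine (TensorProduct.tmul_sum _ _ _).trans (Finset.sum_congr rfl fun b _ => ?_)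
      split_ifs with hb
      · refine (TensorProduct.sum_tmul _ _ _).trans (Finset.sum_congr rfl fun u _ => ?_)
        simp only [← hb, map_mul, eq_inv_mul_iff_mul_eq]
        split_ifs
        · rfl
        · exact TensorProduct.zero_tmul _ _
      · exact TensorProduct.tmul_zero _ _
    refine (Finset.sum_congr rfl fun x _ => l x).trans
      (Eq.trans ?_ (Finset.sum_congr rfl fun a _ => (r a).symm))
    rw [Finset.sum_comm]
    conv_rhs => rw [Finset.sum_comm]
    refine Finset.sum_congr rfl fun b _ => ?_
    simp only [Finset.sum_ite_eq, Finset.mem_univ, if_true]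
    exact Fintype.sum_equiv (Equiv.mulLeft b⁻¹) _ _ fun x => by simp
  · obtain ⟨y, rfl⟩ := hq g
    refine LinearMap.congr_fun (f := (descend hq X hX ⊗ descend hq Y hY).act (grp k (q y)))
      (g := (descend hq (X ⊗ Y) h).act (grp k (q y))) (TensorProduct.ext' fun m n => ?_)
    refine (act_grp_tmul _ _ (q y) m n).trans
      ((descend_act_grp hq (X ⊗ Y) h y (m ⊗ₜ[k] n)).trans ?_).symm
    rw [act_grp_tmul, descend_act_grp, descend_act_grp]

/-- In `R = ∑_x x ⊗ e_x` the operator `x` depends only on `q x`. Grouping the terms by fibres gives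
the `R`-matrix of `D(G)`. -/
theorem descend_braid {X Y : DGMod k E} (hX : KerTrivial q X) (hY : KerTrivial q Y)
    (z : X.V ⊗[k] Y.V) : (Hom.lin (braid X Y).hom z : Y.V ⊗[k] X.V) =
      Hom.lin (braid (descend hq X hX) (descend hq Y hY)).hom z := by
  refine LinearMap.congr_fun (f := Hom.lin (M := X ⊗ Y) (N := Y ⊗ X) (braid X Y).hom)
    (g := Hom.lin (M := descend hq X hX ⊗ descend hq Y hY)
      (N := descend hq Y hY ⊗ descend hq X hX) (braid (descend hq X hX) (descend hq Y hY)).hom)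
    (TensorProduct.ext' fun m n => ?_) z
  refine (braid_tmul X Y m n).trans
    ((braid_tmul (descend hq X hX) (descend hq Y hY) m n).trans ?_).symm
  have h1 : ∀ g : G, ((descend hq Y hY).act (e k g 1) n ⊗ₜ (descend hq X hX).act (grp k g) m :
      Y.V ⊗[k] X.V) = ∑ x : E, if q x = g then
        Y.act (e k x 1) n ⊗ₜ[k] X.act (grp k x) m else 0 := fun g => by
    rw [descend_act_e_one]
    refine (TensorProduct.sum_tmul _ _ _).trans (Finset.sum_congr rfl fun x _ => ?_)
    split_ifs with h
    · rw [← h, descend_act_grp]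
    · exact TensorProduct.zero_tmul _ _
  refine (Finset.sum_congr rfl fun g _ => h1 g).trans ?_
  rw [Finset.sum_comm]
  simp

end Descend

end DGMod
end Double

/-! ### The descent functor, and induced modules for dominance. -/

section Double

open DrinfeldDouble FDMod

variable {k : Type u} [Field k] {G : Type v} [Group G] [Fintype G] [DecidableEq G]

namespace DGMod

variable {E : Type*} [Group E] [Fintype E] [DecidableEq E] {q : E →* G}

section Functor

variable (hq : Function.Surjective q) (P : ObjectProperty (DGMod k E))
  (hP : ∀ X, P X → KerTrivial q X)

/-- The functor from `D(E)`-modules on which the kernel of `q : E → G` acts trivially to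
`D(G)`-modules. -/
noncomputable def descendFunctor : P.FullSubcategory ⥤ DGMod k G where
  obj X := descend hq X.obj (hP _ X.property)
  map {X Y} f := ⟨Hom.lin (M := X.obj) (N := Y.obj) f.hom,
    descend_comm hq (hP _ X.property) (hP _ Y.property) f.hom⟩

variable [P.IsMonoidal]

/-- The monoidal structure of `descendFunctor`, given by identity maps. -/
noncomputable def descendCoreMonoidal : (descendFunctor hq P hP).CoreMonoidal where
  εIso := isoMk (N := (descendFunctor hq P hP).obj (𝟙_ _)) (LinearEquiv.refl k k)
    (descend_unit hq (hP _ P.prop_unit))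
  μIso X Y := isoMk (M := (descendFunctor hq P hP).obj X ⊗ (descendFunctor hq P hP).obj Y)
    (N := (descendFunctor hq P hP).obj (X ⊗ Y))
    (LinearEquiv.refl k (X.obj.V ⊗[k] Y.obj.V))
    (descend_tensor hq (hP _ X.property) (hP _ Y.property) (hP _ (X ⊗ Y).property))
  μIso_hom_natural_left _ _ := rfl
  μIso_hom_natural_right _ _ := rfl
  associativity _ _ _ := hom_ext (TensorProduct.ext_threefold fun _ _ _ => rfl)
  left_unitality _ := hom_ext (TensorProduct.ext' fun _ _ => rfl)
  right_unitality _ := hom_ext (TensorProduct.ext' fun _ _ => rfl)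

noncomputable instance : (descendFunctor hq P hP).Braided where
  toMonoidal := (descendCoreMonoidal hq P hP).toMonoidal
  braided X Y := hom_ext (LinearMap.ext fun z =>
    descend_braid hq (hP _ X.property) (hP _ Y.property) z)

end Functor

section Induced

variable (q) (Y : DGMod k G)

/-- The functions from `E` to a `D(G)`-module, with the grading and the action of `E` on them. -/
noncomputable def inducedRep : GradedRep k E (E → Y.V) where
  proj x := LinearMap.single k _ x ∘ₗ LinearMap.proj x
  rep :=
    -- The action is `(h f)(x) = q(h) f(h⁻¹ x h)`, and degree `x` consists of the functions
    -- supported at `x`. The grading of `Y` plays no role yet; it serves to cut out `Y` as a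
    -- summand.
    { toFun := fun h => LinearMap.pi fun x => Y.act (grp k (q h)) ∘ₗ LinearMap.proj (h⁻¹ * x * h)
      map_one' := by ext; simp [grp_one]
      map_mul' := fun g h => by
        refine LinearMap.ext fun f => funext fun x => ?_
        change Y.act (grp k (q (g * h))) (f ((g * h)⁻¹ * x * (g * h))) =
          Y.act (grp k (q g)) (Y.act (grp k (q h)) (f (h⁻¹ * (g⁻¹ * x * g) * h)))
        rw [act_grp_grp, map_mul]
        congr 2
        group }
  proj_mul_proj g h := by
    refine LinearMap.ext fun f => funext fun x => ?_
    change (Pi.single g ((Pi.single h (f h) : E → Y.V) g) : E → Y.V) x = _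
    by_cases hgh : g = h
    · subst hgh
      simp
    · simp [hgh]
  sum_proj := by
    refine LinearMap.ext fun f => ?_
    simp [LinearMap.sum_apply, Finset.univ_sum_single]
  rep_mul_proj g h := by
    refine LinearMap.ext fun f => funext fun x => ?_
    change Y.act (grp k (q h)) ((Pi.single g (f g) : E → Y.V) (h⁻¹ * x * h)) =
      (Pi.single (h * g * h⁻¹) (Y.act (grp k (q h)) (f (h⁻¹ * (h * g * h⁻¹) * h))) : E → Y.V) x
    by_cases hx : x = h * g * h⁻¹
    · subst hx
      have : h⁻¹ * (h * g * h⁻¹) * h = g := by group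
      rw [this, Pi.single_eq_same, Pi.single_eq_same]
    · rw [Pi.single_eq_of_ne hx, Pi.single_eq_of_ne, map_zero]
      rintro rfl
      apply hx
      group

/-- The `D(E)`-module of functions from `E` to a `D(G)`-module. -/
noncomputable def induced : DGMod k E := ofAct (E → Y.V) (inducedRep q Y).act

/-- An element of the induced module, as a function. -/
noncomputable def inducedEquiv : (induced q Y).V ≃ₗ[k] (E → Y.V) :=
  ofActEquiv (E → Y.V) (inducedRep q Y).act

theorem inducedEquiv_act_e_one (g : E) (m : (induced q Y).V) (x : E) :
    inducedEquiv q Y ((induced q Y).act (e k g 1) m) x =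
      if x = g then inducedEquiv q Y m x else 0 := by
  refine (congrFun (ofActEquiv_act (E → Y.V) (inducedRep q Y).act (e k g 1) m) x).trans ?_
  rw [GradedRep.act_e_one]
  change (Pi.single g (inducedEquiv q Y m g) : E → Y.V) x = _
  split_ifs with h
  · subst h
    simp
  · simp [h]

theorem inducedEquiv_act_grp (g : E) (m : (induced q Y).V) (x : E) :
    inducedEquiv q Y ((induced q Y).act (grp k g) m) x =
      Y.act (grp k (q g)) (inducedEquiv q Y m (g⁻¹ * x * g)) := by
  refine (congrFun (ofActEquiv_act (E → Y.V) (inducedRep q Y).act (grp k g) m) x).trans ?_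
  rw [GradedRep.act_grp]
  rfl

/-- Centrality of the kernel is essential here: an element `z` of it acts on values through `q z =
1` and on arguments by conjugation, which is trivial. -/
theorem induced_kerTrivial (hc : q.ker ≤ Subgroup.center E) : KerTrivial q (induced q Y) := by
  refine fun z hz => LinearMap.ext fun m => (inducedEquiv q Y).injective (funext fun x => ?_)
  have hz' : z⁻¹ * x * z = x := by
    rw [mul_assoc, Subgroup.mem_center_iff.1 (hc hz) x, inv_mul_cancel_left]
  rw [inducedEquiv_act_grp, hz, grp_one, map_one, hz']
  rfl

theorem descend_act_induced_e_one (hq : Function.Surjective q)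
    (h : KerTrivial q (induced q Y)) (g : G) (m : (induced q Y).V) (x : E) :
    inducedEquiv q Y ((descend hq (induced q Y) h).act (e k g 1) m) x =
      if q x = g then inducedEquiv q Y m x else 0 := by
  rw [descend_act_e_one, map_sum, Finset.sum_apply]
  simp only [apply_ite (inducedEquiv q Y), map_zero, ite_apply, inducedEquiv_act_e_one,
    Pi.zero_apply]
  rw [Finset.sum_eq_single x]
  · simp
  · intro b _ hb
    simp [hb.symm]
  · simp

/-- A `D(G)`-module is a direct summand of the module induced from it. -/
theorem nonempty_retract_induced [CharZero k] (hq : Function.Surjective q)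
    (h : KerTrivial q (induced q Y)) :
    Nonempty (Retract Y (descend hq (induced q Y) h)) := by
  let n := (Finset.univ.filter fun x => q x = 1).card
  have hn : (n : k) ≠ 0 := Nat.cast_ne_zero.2
    (Finset.card_pos.2 ⟨1, by simp⟩).ne'
  have hc : ∀ g : G, (Finset.univ.filter fun x => q x = g).card = n := fun g =>
    MonoidHom.card_fiber_eq_of_mem_range q (hq g) (hq 1)
  -- A vector `y` is sent to the function `x ↦ e_{q(x)} y`. The retraction sums the values `e_{q(x)}
  -- f(x)` and divides by `n = |ker q|`, because each degree of `G` is counted once for every point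
  -- of its fibre.
  let i₀ : Y.V →ₗ[k] (induced q Y).V := (inducedEquiv q Y).symm.toLinearMap ∘ₗ
    LinearMap.pi fun x => Y.act (e k (q x) 1)
  have hi₀ : ∀ y x, inducedEquiv q Y (i₀ y) x = Y.act (e k (q x) 1) y := fun y x =>
    congrFun ((inducedEquiv q Y).apply_symm_apply _) x
  let r₀ : (induced q Y).V →ₗ[k] Y.V :=
    (n : k)⁻¹ • ∑ x : E, Y.act (e k (q x) 1) ∘ₗ LinearMap.proj x ∘ₗ (inducedEquiv q Y).toLinearMap
  have hr₀ : ∀ m, r₀ m = (n : k)⁻¹ • ∑ x : E, Y.act (e k (q x) 1) (inducedEquiv q Y m x) :=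
    fun m => by simp [r₀, LinearMap.sum_apply]
  have hg : ∀ (g h : E) (m : Y.V), Y.act (e k (q h) 1) (Y.act (grp k (q g)) m) =
      Y.act (grp k (q g)) (Y.act (e k (q (g⁻¹ * h * g)) 1) m) := fun g h m => by
    have := LinearMap.congr_fun (act_grp_mul_act_e Y (q (g⁻¹ * h * g)) (q g)) m
    refine Eq.trans ?_ this.symm
    have h1 : q g * q (g⁻¹ * h * g) * (q g)⁻¹ = q h := by
      rw [← map_inv, ← map_mul, ← map_mul]
      congr 1
      group
    rw [h1]
    rfl
  refine ⟨⟨⟨i₀, comm_of_generators (M := Y) (N := descend hq (induced q Y) h) i₀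
    (fun g y => (inducedEquiv q Y).injective (funext fun x => ?_))
    (fun g y => (inducedEquiv q Y).injective (funext fun x => ?_))⟩,
    ⟨r₀, comm_of_generators (M := descend hq (induced q Y) h) (N := Y) r₀
    (fun g m => ?_) (fun g m => ?_)⟩, hom_ext (LinearMap.ext fun y => ?_)⟩⟩
  · rw [descend_act_induced_e_one, hi₀, hi₀, act_e_e]
  · obtain ⟨g, rfl⟩ := hq g
    rw [descend_act_grp, inducedEquiv_act_grp, hi₀, hi₀, hg]
  · rw [hr₀, hr₀, map_smul, map_sum]
    congr 1
    refine Finset.sum_congr rfl fun x _ => ?_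
    rw [descend_act_induced_e_one, act_e_e]
    by_cases hx : q x = g
    · simp [hx]
    · simp [hx, Ne.symm hx]
  · obtain ⟨g, rfl⟩ := hq g
    rw [hr₀, hr₀, map_smul, map_sum, descend_act_grp]
    congr 1
    refine Fintype.sum_equiv (MulAut.conj g⁻¹).toEquiv _ _ fun x => ?_
    rw [inducedEquiv_act_grp, hg]
    simp
  · change r₀ (i₀ y) = y
    rw [hr₀]
    have h1 : ∀ x : E, Y.act (e k (q x) 1) (inducedEquiv q Y (i₀ y) x) =
        ∑ g : G, if q x = g then Y.act (e k g 1) y else 0 := fun x => by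
      rw [hi₀, act_e_e]
      simp
    rw [Finset.sum_congr rfl fun x _ => h1 x, Finset.sum_comm]
    have h2 : ∀ g : G, ∑ x : E, (if q x = g then Y.act (e k g 1) y else 0) =
        (n : k) • Y.act (e k g 1) y := fun g => by
      rw [← Finset.sum_filter, Finset.sum_const, hc, Nat.cast_smul_eq_nsmul]
    rw [Finset.sum_congr rfl fun g _ => h2 g, ← Finset.smul_sum, inv_smul_smul₀ hn,
      ← LinearMap.sum_apply, ← map_sum, ← one_eq, map_one]
    rfl

end Induced

/-! ### The grading by characters of `A`. -/

section Component

variable {A : Type w} [Group A] (ι : A →* Subgroup.center G)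

theorem component_one_iff (X : DGMod k G) : component ι (1 : A →* kˣ) X ↔
    ∀ a : A, X.act (grp k (ι a : G)) = 1 := by
  rw [component_iff]
  refine forall_congr' fun a => ⟨fun h => LinearMap.ext fun x => ?_, fun h x => ?_⟩
  · simpa using h x
  · simp [h]

theorem antipode_grp (h : G) : HopfAlgebraStruct.antipode k (grp k h) = grp k h⁻¹ := by
  simp only [grp, map_sum, antipode_e]
  exact Fintype.sum_equiv ((Equiv.inv G).trans (MulAut.conj h⁻¹).toEquiv) _ _ fun x => by
    simp

theorem component_one_isPremodular [CharZero k] :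
    IsPremodular k ((twist k G).restrict (component ι (1 : A →* kˣ))) := by
  refine isPremodular_restrict _ (fun M hM => ?_) (fun M N i hi hM => ?_) (fun M N p hp hM => ?_)
    fun M N hM hN => ?_
  all_goals rw [component_one_iff] at *; intro a
  · refine LinearMap.ext fun φ => LinearMap.ext fun m => ?_
    rw [dual_act, antipode_grp]
    have := hM a⁻¹
    rw [map_inv] at this
    exact congrArg φ (LinearMap.congr_fun this m)
  · refine LinearMap.ext fun n => hi ?_
    rw [Hom.comm i, hM]
    rfl
  · refine LinearMap.ext fun n => ?_
    obtain ⟨m, rfl⟩ := hp n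
    rw [← Hom.comm p, hM]
    rfl
  · refine LinearMap.ext fun n => ?_
    exact Prod.ext (LinearMap.congr_fun (hM a) n.1) (LinearMap.congr_fun (hN a) n.2)

theorem component_unique {α β : A →* kˣ} {X : DGMod k G} [Nontrivial X.V]
    (hα : component ι α X) (hβ : component ι β X) : α = β := by
  rw [component_iff] at hα hβ
  obtain ⟨x, hx⟩ := exists_ne (0 : X.V)
  refine MonoidHom.ext fun a => Units.ext (smul_left_injective k hx ?_)
  exact (hα a x).symm.trans (hβ a x)

theorem grp_center_comm (z : Subgroup.center G) (x : DrinfeldDouble k G) :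
    grp k (z : G) * x = x * grp k (z : G) := by
  induction x using DrinfeldDouble.induction with
  | h0 => simp
  | hadd x y hx hy => simp only [mul_add, add_mul, hx, hy]
  | hsmul c x hx => simp only [mul_smul_comm, smul_mul_assoc, hx]
  | he g h =>
    have hz := Subgroup.mem_center_iff.1 z.2
    rw [grp_mul_e, e_mul_grp, ← hz g, mul_inv_cancel_right, hz h]

/-- Central group elements act by scalars by Schur's lemma. Comparing the actions on one nonzero
vector shows that the scalars are multiplicative, and as `A` is a group they are units. -/
theorem exists_component [IsAlgClosed k] (X : DGMod k G) [Simple X] :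
    ∃ α : A →* kˣ, component ι α X := by
  have := nontrivial_of_simple X
  obtain ⟨x, hx⟩ := exists_ne (0 : X.V)
  choose c hc using fun a => exists_smul_id X (centralEnd X _ (grp_center_comm (k := k) (ι a)))
  have hc' : ∀ a x, X.act (grp k (ι a : G)) x = c a • x := fun a x =>
    LinearMap.congr_fun (hc a) x
  let χ : A →* k :=
    { toFun := c
      map_one' := smul_left_injective k hx <| by
        change c 1 • x = (1 : k) • x
        rw [← hc', map_one, one_smul]
        change X.act (grp k 1) x = x
        rw [grp_one, map_one]
        rfl
      map_mul' := fun a b => smul_left_injective k hx <| by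
        change c (a * b) • x = (c a * c b) • x
        rw [← hc', mul_smul, ← hc' b, ← hc' a, act_grp_grp, map_mul]
        rfl }
  exact ⟨χ.toHomUnits, (component_iff _ _ _).2 hc'⟩

theorem component_tensor (α β : A →* kˣ) (X Y : DGMod k G) (hX : component ι α X)
    (hY : component ι β Y) : component ι (α * β) (X ⊗ Y) := by
  rw [component_iff] at *
  intro a z
  refine LinearMap.congr_fun (f := (X ⊗ Y).act (grp k (ι a : G)))
    (g := ((α * β) a : k) • LinearMap.id) (TensorProduct.ext' fun x y => ?_) z
  refine (act_grp_tmul X Y _ x y).trans ?_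
  rw [hX, hY, TensorProduct.smul_tmul_smul]
  rfl

/-- For the converse, `X` has some degree `β` by simplicity, and one nonzero vector of `e_g X`
forces `α = β`. -/
theorem component_iff_centralizerRep [IsAlgClosed k] (X : DGMod k G) [Simple X] (g : G)
    (hg : X.degreeSpace g ≠ ⊥) (α : A →* kˣ) : component ι α X ↔ ∀ a : A,
      X.centralizerRep g (toCentralizer (ι a) g) = (α a : k) • LinearMap.id := by
  have := nontrivial_of_simple X
  constructor
  · intro h a
    exact LinearMap.ext fun x => Subtype.ext ((component_iff _ _ _).1 h a x)
  · intro h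
    obtain ⟨β, hβ⟩ := exists_component ι X
    obtain ⟨x, hx, hx0⟩ := Submodule.exists_mem_ne_zero_of_ne_bot hg
    have : α = β := MonoidHom.ext fun a => Units.ext <| smul_left_injective k hx0 <| by
      have h1 := congrArg Subtype.val (LinearMap.congr_fun (h a) ⟨x, hx⟩)
      exact h1.symm.trans ((component_iff _ _ _).1 hβ a x)
    rwa [this]

end Component

/-! ### The central extension and the final assembly. -/

section Extension

variable {A : Type w} [Group A] (S : GroupExtension A E G)
  (hS : S.inl.range ≤ Subgroup.center E)

omit [Fintype G] [DecidableEq G] in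
theorem component_one_iff_kerTrivial (X : DGMod k E) :
    component (centralInl S hS) (1 : A →* kˣ) X ↔ KerTrivial S.rightHom X := by
  rw [component_one_iff]
  constructor
  · intro h x hx
    have hx' : x ∈ S.inl.range := by
      rw [S.range_inl_eq_ker_rightHom]
      exact hx
    obtain ⟨a, rfl⟩ := hx'
    exact h a
  · intro h a
    refine h _ ?_
    change S.inl a ∈ S.rightHom.ker
    rw [← S.range_inl_eq_ker_rightHom]
    exact ⟨a, rfl⟩

/-- `D(G)`-modules are the modularization of the component of trivial degree. -/
theorem isModularization_descendFunctor [IsAlgClosed k] [CharZero k] :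
    IsModularization k ((twist k E).restrict (component (centralInl S hS) (1 : A →* kˣ)))
      (twist k G) (descendFunctor S.rightHom_surjective _
        fun X => (component_one_iff_kerTrivial S hS X).1) where
  premodular := component_one_isPremodular _
  modular := isModular
  additive := ⟨rfl⟩
  linear := ⟨fun _ _ => rfl⟩
  twist X := hom_ext (LinearMap.ext fun m => (descend_act_twistElt _ X.obj _ m).symm)
  dominant Y := by
    -- By exactness the kernel of `E → G` is the image of `A`, so it is central and the induced
    -- module has trivial degree.
    have h := induced_kerTrivial S.rightHom Y (S.range_inl_eq_ker_rightHom ▸ hS)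
    exact ⟨⟨_, (component_one_iff_kerTrivial S hS _).2 h⟩,
      nonempty_retract_induced S.rightHom Y S.rightHom_surjective h⟩

end Extension

end DGMod
end Double

theorem mainTheorem8 {k : Type u} [Field k] [IsAlgClosed k] [CharZero k]
    {A E G : Type*} [Group A] [IsCyclic A]
    [Group E] [Fintype E] [DecidableEq E] [Group G] [Fintype G] [DecidableEq G]
    (S : GroupExtension A E G) (hS : S.inl.range ≤ Subgroup.center E) :
    -- the components define a grading of `D(E)`-mod by the group of characters of `A`
    (∀ X : DGMod k E, Simple X → ∃! α : A →* kˣ, DGMod.component (DGMod.centralInl S hS) α X) ∧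
    (∀ (α β : A →* kˣ) (X Y : DGMod k E), DGMod.component (DGMod.centralInl S hS) α X →
      DGMod.component (DGMod.centralInl S hS) β Y →
      DGMod.component (DGMod.centralInl S hS) (α * β) (X ⊗ Y)) ∧
    -- the degree is given by the action of `A` on representations of centralizers
    (∀ (X : DGMod k E) (g : E), Simple X → X.degreeSpace g ≠ ⊥ → ∀ α : A →* kˣ,
      (DGMod.component (DGMod.centralInl S hS) α X ↔ ∀ a : A,
        X.centralizerRep g (DGMod.toCentralizer (DGMod.centralInl S hS a) g) =
          (α a : k) • LinearMap.id)) ∧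
    -- the category `D(G)`-mod is the modularization of the component of trivial degree
    ∃ (F : (DGMod.component (k := k) (DGMod.centralInl S hS) 1).FullSubcategory ⥤ DGMod k G)
      (_ : F.Braided),
      IsModularization k
        ((DGMod.twist k E).restrict (DGMod.component (DGMod.centralInl S hS) 1))
        (DGMod.twist k G) F := by
  refine ⟨fun X hX => ?_, DGMod.component_tensor _, fun X g hX hg α =>
    DGMod.component_iff_centralizerRep _ X g hg α, _, _,
    DGMod.isModularization_descendFunctor S hS⟩
  obtain ⟨α, hα⟩ := DGMod.exists_component (DGMod.centralInl S hS) X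
  have := DGMod.nontrivial_of_simple X
  exact ⟨α, hα, fun β hβ => DGMod.component_unique _ hβ hα⟩
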